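/- Let $n\ge 2$, let $\mathbb{F}_n^+$ be the free monoid of all words (including the empty word $\varnothing$) in $n$ letters, and let $\ell^2(\mathbb{F}_n^+)$ be Fock space, with orthonormal basis $\{\xi_w : w\in\mathbb{F}_n^+\}$ and left creation isometries $L_i\xi_w=\xi_{iw}$, $1\le i\le n$. Let $\mathfrak{A}_n$ be the non-commutative disk algebra, i.e. the norm-closed unital algebra generated by the canonical generators $\mathfrak{s}_1,\dots,\mathfrak{s}_n$, realized by $\mathfrak{s}_i=L_i$; let $\mathfrak{L}_n$ be the closure in the weak operator topology of the unital algebra generated by $L_1,\dots,L_n$, with the weak-$*$ topology inherited from $B(\ell^2(\mathbb{F}_n^+))$ (the dual of the trace class operators); and let $\lambda:\mathfrak{A}_n\to\mathfrak{L}_n$ be the left regular representation, $\lambda(\mathfrak{s}_i)=L_i$. Let $\mathfrak{A}_{n,0}$ be the kernel of the functional $A\mapsto\langle\lambda(A)\xi_\varnothing,\xi_\varnothing\rangle$ on $\mathfrak{A}_n$, and $\mathfrak{A}_{n,0}^k$ the $k$-th power of this ideal. A functional $\phi\in\mathfrak{A}_n^*$ (bounded and linear) is called absolutely continuous if there are $\zeta,\eta\in\ell^2(\mathbb{F}_n^+)$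 with $\phi(A)=\langle\lambda(A)\zeta,\eta\rangle$ for all $A\in\mathfrak{A}_n$; let $\mathfrak{A}_n^a$ be the set of these functionals. (a) For every $\phi\in\mathfrak{A}_n^*$ the following are equivalent: (1) $\phi$ is absolutely continuous; (2) $\phi\circ\lambda^{-1}$ extends to a weak-$*$ continuous linear functional on $\mathfrak{L}_n$; (3) $\lim_{k\to\infty}\big\|\phi|_{\mathfrak{A}_{n,0}^k}\big\|=0$. Moreover, if $\phi$ is absolutely continuous, then for every $\varepsilon>0$ the vectors $\zeta,\eta$ with $\phi(A)=\langle\lambda(A)\zeta,\eta\rangle$ $(A\in\mathfrak{A}_n)$ may be chosen so that $\|\zeta\|\,\|\eta\|<\|\phi\|+\varepsilon$. (b) $\mathfrak{A}_n^a$ is a norm-closed linear subspace of $\mathfrak{A}_n^*$ and is the predual of $\mathfrak{L}_n$. That is, the map $\psi\mapsto\psi\circ\lambda$ is an isometric linear isomorphism $R$ from the space of weak-$*$ continuous linear functionals on $\mathfrak{L}_n$ (with the norm of $\mathfrak{L}_n^*$) onto $\mathfrak{A}_n^a$; and there is an isometric linear isomorphism $\Theta:\mathfrak{L}_n\to(\mathfrak{A}_n^a)^*$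 with $\Theta(T)(R\psi)=\psi(T)$ for all $T\in\mathfrak{L}_n$ and all weak-$*$ continuous functionals $\psi$, which is a homeomorphism between the weak-$*$ topology of $\mathfrak{L}_n$ and the weak-$*$ topology $\sigma((\mathfrak{A}_n^a)^*,\mathfrak{A}_n^a)$. -/

import Mathlib

open Filter Topology
open scoped lp InnerProductSpace

noncomputable section

namespace FreeSemigroup

/-- The Banach space dual of a complex normed space. -/
abbrev BDual (X : Type*) [NormedAddCommGroup X] [NormedSpace ℂ X] : Type _ := StrongDual ℂ X

/-- Fock space `ℓ²(𝔽ₙ⁺)`, where the free semigroup `𝔽ₙ⁺` is the monoid of all words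
(including the empty one) on `n` letters. -/
abbrev Fock (n : ℕ) : Type := ℓ²(FreeMonoid (Fin n), ℂ)

/-- Bounded operators on Fock space. -/
abbrev FockOp (n : ℕ) : Type := Fock n →L[ℂ] Fock n

open scoped Classical in
/-- The canonical orthonormal basis vector `ξ_w` of Fock space. -/
def xi {n : ℕ} (w : FreeMonoid (Fin n)) : Fock n := lp.single 2 w (1 : ℂ)

open scoped Classical in
theorem inner_xi {n : ℕ} (w : FreeMonoid (Fin n)) (f : Fock n) :
    inner ℂ (xi w) f = f w := by
  simp [xi, lp.inner_single_left]

open scoped Classical in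
theorem orthonormal_xi (n : ℕ) :
    Orthonormal ℂ (fun w : FreeMonoid (Fin n) => (xi w : Fock n)) := by
  rw [orthonormal_iff_ite]
  intro v w
  rw [inner_xi]
  by_cases h : v = w
  · subst h; simp [xi]
  · rw [if_neg h]
    simp [xi, Pi.single_eq_of_ne h]

theorem orthonormal_xi_of_mul {n : ℕ} (i : Fin n) :
    Orthonormal ℂ (fun w : FreeMonoid (Fin n) => (xi (FreeMonoid.of i * w) : Fock n)) :=
  (orthonormal_xi n).comp _ (mul_right_injective (FreeMonoid.of i))

/-- The left creation operator `L_i`: the isometry of Fock space with `L_i ξ_w = ξ_{iw}`. -/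
def leftCreation {n : ℕ} (i : Fin n) : FockOp n :=
  (orthonormal_xi_of_mul i).orthogonalFamily.linearIsometry.toContinuousLinearMap

open scoped Classical in
theorem leftCreation_xi {n : ℕ} (i : Fin n) (w : FreeMonoid (Fin n)) :
    leftCreation i (xi w) = xi (FreeMonoid.of i * w) := by
  change (orthonormal_xi_of_mul i).orthogonalFamily.linearIsometry (lp.single 2 w (1 : ℂ)) = _
  rw [OrthogonalFamily.linearIsometry_apply_single]
  simp

/-- The unital algebra generated by `L_1, …, L_n` (without adjoints). -/
def polyAlgebra (n : ℕ) : Subalgebra ℂ (FockOp n) :=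
  Algebra.adjoin ℂ (Set.range (leftCreation (n := n)))

/-- The non-commutative disk algebra `𝔄ₙ`: the norm-closed unital algebra generated by the
canonical generators `𝔰_i = L_i` of the Cuntz–Toeplitz algebra `ℰₙ = C*(L_1, …, L_n)`. -/
def ncDiskAlgebra (n : ℕ) : Subalgebra ℂ (FockOp n) :=
  (polyAlgebra n).topologicalClosure

section Hilbert

variable {H : Type*} [NormedAddCommGroup H] [InnerProductSpace ℂ H] [CompleteSpace H]

open ContinuousLinearMapWOT in
/-- The closure of a unital operator algebra in the weak operator topology. -/
def wotClosure (S : Subalgebra ℂ (H →L[ℂ] H)) : Subalgebra ℂ (H →L[ℂ] H) where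
  carrier := {T | (ofCLM T : H →WOT[ℂ] H) ∈ closure (ofCLM '' (S : Set (H →L[ℂ] H)))}
  algebraMap_mem' c := subset_closure ⟨_, S.algebraMap_mem c, rfl⟩
  add_mem' {a b} ha hb := by
    refine map_mem_closure₂ (f := fun x y : H →WOT[ℂ] H => x + y) continuous_add ha hb ?_
    rintro _ ⟨x, hx, rfl⟩ _ ⟨y, hy, rfl⟩
    exact ⟨x + y, S.add_mem hx hy, rfl⟩
  mul_mem' {a b} ha hb := by
    have hl : ∀ x : H →WOT[ℂ] H, Continuous fun y : H →WOT[ℂ] H => x * y := by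
      intro x
      rw [ContinuousLinearMapWOT.continuous_iff]
      intro u v
      have : ∀ y : H →WOT[ℂ] H,
          inner ℂ v ((x * y) u) = inner ℂ (ContinuousLinearMap.adjoint x.toCLM v) (y u) := by
        intro y
        rw [ContinuousLinearMap.adjoint_inner_left]
        rfl
      simp only [this]
      exact (ContinuousLinearMapWOT.continuous_iff.mp continuous_id) u _
    have hr : ∀ y : H →WOT[ℂ] H, Continuous fun x : H →WOT[ℂ] H => x * y := by
      intro y
      rw [ContinuousLinearMapWOT.continuous_iff]
      intro u v
      exact (ContinuousLinearMapWOT.continuous_iff.mp continuous_id) (y u) v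
    have h1 : ∀ x ∈ S, (ofCLM (x * b) : H →WOT[ℂ] H) ∈
        closure (ofCLM '' (S : Set (H →L[ℂ] H))) := by
      intro x hx
      refine map_mem_closure (f := fun y => ofCLM x * y) (hl _) hb ?_
      rintro _ ⟨y, hy, rfl⟩
      exact ⟨x * y, S.mul_mem hx hy, rfl⟩
    have h2 : (ofCLM (a * b) : H →WOT[ℂ] H) ∈
        closure (closure (ofCLM '' (S : Set (H →L[ℂ] H)))) := by
      refine map_mem_closure (f := fun x => x * ofCLM b) (hr _) ha ?_
      rintro _ ⟨x, hx, rfl⟩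
      exact h1 x hx
    rwa [closure_closure] at h2

theorem topologicalClosure_le_wotClosure (S : Subalgebra ℂ (H →L[ℂ] H)) :
    S.topologicalClosure ≤ wotClosure S := by
  have hc : Continuous (ContinuousLinearMapWOT.ofCLM : (H →L[ℂ] H) → (H →WOT[ℂ] H)) := by
    rw [ContinuousLinearMapWOT.continuous_iff]
    intro u v
    simp only [ContinuousLinearMapWOT.ofCLM_apply]
    fun_prop
  intro T hT
  exact map_mem_closure hc hT fun x hx => ⟨x, hx, rfl⟩

variable (H) in
/-- The weak-* (ultraweak, σ-weak) topology of `B(H)` as the dual of the trace class operators: the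
coarsest topology for which all functionals `A ↦ ∑ ⟨A x_i, y_i⟩` with `∑ ‖x_i‖² < ∞` and
`∑ ‖y_i‖² < ∞` (the pairings of `A` with trace class operators) are continuous. -/
@[reducible] def ultraweakTopology : TopologicalSpace (H →L[ℂ] H) :=
  ⨅ (x : ℕ → H) (y : ℕ → H) (_ : Summable fun i => ‖x i‖ ^ 2) (_ : Summable fun i => ‖y i‖ ^ 2),
    TopologicalSpace.induced (fun A : H →L[ℂ] H => ∑' i, inner ℂ (y i) (A (x i))) inferInstance

end Hilbert

/-- The non-commutative analytic Toeplitz algebra `𝔏ₙ`: the WOT-closed unital algebra generated by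
`L_1, …, L_n`. -/
def ncToeplitzAlgebra (n : ℕ) : Subalgebra ℂ (FockOp n) := wotClosure (polyAlgebra n)

/-- `𝔄ₙ` as a normed algebra (with the operator norm). -/
def NCDisk (n : ℕ) : Type := ↥(ncDiskAlgebra n)

instance (n : ℕ) : NormedRing (NCDisk n) := inferInstanceAs (NormedRing ↥(ncDiskAlgebra n))

instance (n : ℕ) : NormedAlgebra ℂ (NCDisk n) :=
  inferInstanceAs (NormedAlgebra ℂ ↥(ncDiskAlgebra n))

/-- `𝔏ₙ` as a normed algebra (with the operator norm). -/
def NCToeplitz (n : ℕ) : Type := ↥(ncToeplitzAlgebra n)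

instance (n : ℕ) : NormedRing (NCToeplitz n) := inferInstanceAs (NormedRing ↥(ncToeplitzAlgebra n))

instance (n : ℕ) : NormedAlgebra ℂ (NCToeplitz n) :=
  inferInstanceAs (NormedAlgebra ℂ ↥(ncToeplitzAlgebra n))

/-- The inclusion of `𝔏ₙ` in `B(ℓ²(𝔽ₙ⁺))`. -/
def NCToeplitz.toOp (n : ℕ) : NCToeplitz n →ₐ[ℂ] FockOp n := (ncToeplitzAlgebra n).val

/-- The left regular representation `λ : 𝔄ₙ → 𝔏ₙ`, sending `𝔰_i` to `L_i`. -/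
def leftRegular (n : ℕ) : NCDisk n →ₐ[ℂ] NCToeplitz n :=
  Subalgebra.inclusion (topologicalClosure_le_wotClosure (polyAlgebra n))

/-- The weak-* topology of `𝔏ₙ`, inherited from `B(ℓ²(𝔽ₙ⁺))`. -/
@[reducible] def weakStarTopology (n : ℕ) : TopologicalSpace (NCToeplitz n) :=
  TopologicalSpace.induced (NCToeplitz.toOp n) (ultraweakTopology (Fock n))

/-- Weak-* continuity of a scalar function on `𝔏ₙ`. -/
def IsWeakStarContinuous {n : ℕ} (ψ : NCToeplitz n → ℂ) : Prop :=
  Continuous[weakStarTopology n, inferInstance] ψ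

/-- The predual of `𝔏ₙ`: the space of weak-* continuous functionals, normed as a subspace of the
Banach space dual of `𝔏ₙ`. -/
def predual (n : ℕ) : Submodule ℂ (BDual (NCToeplitz n)) where
  carrier := {ψ | IsWeakStarContinuous (ψ : NCToeplitz n → ℂ)}
  zero_mem' := @continuous_const _ _ (weakStarTopology n) _ _
  add_mem' {a b} ha hb := by
    let _ := weakStarTopology n
    have ha' : Continuous (a : NCToeplitz n → ℂ) := ha
    have hb' : Continuous (b : NCToeplitz n → ℂ) := hb
    exact (ha'.add hb' :)
  smul_mem' c a ha := by
    let _ := weakStarTopology n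
    have ha' : Continuous (a : NCToeplitz n → ℂ) := ha
    exact (ha'.const_smul c :)

/-- `φ` is the functional `A ↦ ⟨λ(A)ζ, η⟩` on `𝔄ₙ`. (Mathlib's inner product is linear in the
second variable.) -/
def IsVectorFunctional {n : ℕ} (φ : BDual (NCDisk n)) (ζ η : Fock n) : Prop :=
  ∀ A : NCDisk n, φ A = inner ℂ η (NCToeplitz.toOp n (leftRegular n A) ζ)

/-- A functional on `𝔄ₙ` is absolutely continuous if it is given by vectors of Fock space through
the left regular representation. -/
def IsAbsolutelyContinuous {n : ℕ} (φ : BDual (NCDisk n)) : Prop :=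
  ∃ ζ η : Fock n, IsVectorFunctional φ ζ η

/-- The ideal `𝔄ₙ,₀`, the kernel of the functional `φ₀` which reads off the Fourier coefficient
`a_∅ = ⟨λ(A) ξ_∅, ξ_∅⟩`. -/
def augmentationIdeal (n : ℕ) : Submodule ℂ (NCDisk n) where
  carrier := {A | inner ℂ (xi 1 : Fock n) (NCToeplitz.toOp n (leftRegular n A) (xi 1)) = 0}
  zero_mem' := by simp
  add_mem' {a b} ha hb := by
    simp only [Set.mem_ofPred_eq] at ha hb ⊢
    simp [ha, hb]
  smul_mem' c a ha := by
    simp only [Set.mem_ofPred_eq] at ha ⊢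
    simp [ha]

/-- The `k`-th power `𝔄ₙ,₀ᵏ` of the ideal `𝔄ₙ,₀`: the linear span of all `k`-fold products of its
elements (and the whole algebra when `k = 0`). -/
def augmentationIdealPow (n : ℕ) : ℕ → Submodule ℂ (NCDisk n)
  | 0 => ⊤
  | k + 1 => augmentationIdeal n ^ (k + 1)

end FreeSemigroup

end

/-!
The theorem rests on three facts about Fock space.

*Fejér means.* Right creation operators `R_v ξ_w = ξ_{wv}` commute with the `L_i`, hence with `𝔏ₙ`.
An operator `T` in their commutant is determined by `T ξ_∅ = ∑ a_w ξ_w`, and its Fejér mean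
`Σ_k(T) = ∑_{|w| < k} (1 - |w| / k) a_w L_w` is a Schur multiple of `T`: it is `1 / k` times the sum
of the compressions of `T` to the `k`-windows of degrees. As every degree lies in `k` windows,
`‖Σ_k(T)‖ ≤ ‖T‖` (`norm_fejer_le`), and `Σ_k(T) → T` weakly. Consequently the commutant of the right
creation operators is `𝔏ₙ` (`rightCommutant_eq_ncToeplitzAlgebra`), and a functional
`T ↦ ⟨Tζ, η⟩` has the same norm on `𝔏ₙ` as on `𝔄ₙ` (`norm_toeplitzVectorFunctional`).

*Amplification.* For `n ≥ 2` there are infinitely many right creation operators with pairwise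
orthogonal ranges; they embed the sum of countably many copies of Fock space in Fock space, in a way
that intertwines `T ⊗ 1` with `T` for `T ∈ 𝔏ₙ`. Hence a series `∑ ⟨T x_i, y_i⟩` with `∑ ‖x_i‖²` and
`∑ ‖y_i‖²` finite is a single `⟨Tζ, η⟩` with `‖ζ‖² = ∑ ‖x_i‖²` and `‖η‖² = ∑ ‖y_i‖²`
(`exists_vector_of_summable`). So absolutely continuous functionals form a linear space, and the
weak-* topology of `𝔏ₙ` is generated by the functionals `T ↦ ⟨Tζ, η⟩` (`weakStarTopology_eq`).

*Duality.* A bounded functional `F` on `𝔄ₙ*` gives the bounded sesquilinear form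
`(ζ, η) ↦ F(⟨λ(·)ζ, η⟩)`, which is represented by an operator; the operator commutes with the right
creation operators and so belongs to `𝔏ₙ` (`exists_op_of_dual`). With the equality of norms above,
the Hahn–Banach theorem shows that an absolutely continuous `φ` with `‖φ‖ < r` is a norm limit of
vector functionals with `‖ζ‖², ‖η‖² ≤ r`. Successive approximation followed by amplification writes
every norm limit `φ` of absolutely continuous functionals as one vector functional with
`‖ζ‖ ‖η‖ < ‖φ‖ + ε` (`exists_vectorFunctional_eq`), which is both the norm control and the
closedness of `𝔄ₙᵃ`. The same representation of `F` identifies `𝔏ₙ` with the dual of `𝔄ₙᵃ`.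

Finally, elements of `𝔄ₙ,₀ᵏ` raise degrees by `k`, so absolutely continuous functionals tend to
`0` in norm on these ideals. Conversely, the de la Vallée Poussin means `V_k = 2 Σ_{2k} - Σ_k` are
uniformly bounded and `A - V_k(A) ∈ 𝔄ₙ,₀ᵏ` for polynomials `A`; if `φ` tends to `0` on the ideals,
it is the norm limit of the functionals `φ ∘ V_k`, which involve finitely many Fourier coefficients and
are therefore absolutely continuous.
-/

open Filter Topology
open scoped lp InnerProductSpace

noncomputable section

namespace FreeSemigroup

variable {n : ℕ}

/-! ### Coordinates of Fock space -/

open scoped Classical in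
theorem xi_apply (v w : FreeMonoid (Fin n)) :
    (xi v : Fock n) w = if v = w then 1 else 0 := by
  rw [← inner_xi, orthonormal_iff_ite.mp (orthonormal_xi n)]
  simp [eq_comm]

theorem norm_xi (w : FreeMonoid (Fin n)) : ‖(xi w : Fock n)‖ = 1 := (orthonormal_xi n).1 w

theorem hasSum_smul_xi (x : Fock n) : HasSum (fun w => x w • (xi w : Fock n)) x := by
  classical
  have h : (fun w => x w • (xi w : Fock n)) = fun w => lp.single 2 w (x w) := by
    funext w
    ext v
    rw [lp.coeFn_smul, Pi.smul_apply, xi_apply, lp.coeFn_single, Pi.single_apply]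
    simp [eq_comm]
  rw [h]
  exact lp.hasSum_single (p := 2) (by simp) x

theorem span_xi_dense (n : ℕ) :
    Dense (Submodule.span ℂ (Set.range (xi (n := n))) : Set (Fock n)) := by
  intro x
  refine mem_closure_of_tendsto (hasSum_smul_xi x) (Eventually.of_forall fun s => ?_)
  exact Submodule.sum_mem _ fun w _ => Submodule.smul_mem _ _ (Submodule.subset_span ⟨w, rfl⟩)

theorem clm_ext_xi {F : Type*} [NormedAddCommGroup F] [NormedSpace ℂ F]
    {S T : Fock n →L[ℂ] F} (h : ∀ w, S (xi w) = T (xi w)) : S = T := by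
  refine ContinuousLinearMap.ext_on (span_xi_dense n) ?_
  rintro _ ⟨w, rfl⟩
  exact h w

theorem hasSum_norm_sq {ι : Type*} {G : ι → Type*} [∀ i, NormedAddCommGroup (G i)]
    (x : lp G 2) : HasSum (fun w => ‖x w‖ ^ 2) (‖x‖ ^ 2) := by
  have := lp.hasSum_norm (p := 2) (by simp) x
  simpa using this

/-- Uniformly bounded operators that converge on the basis vectors converge pointwise. -/
theorem tendsto_of_tendsto_xi {F : Type*} [NormedAddCommGroup F] [NormedSpace ℂ F]
    {G : ℕ → Fock n →L[ℂ] F} {T : Fock n →L[ℂ] F} {C : ℝ} (hC : ∀ k, ‖G k‖ ≤ C)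
    (h : ∀ w, Tendsto (fun k => G k (xi w)) atTop (𝓝 (T (xi w)))) (x : Fock n) :
    Tendsto (fun k => G k x) atTop (𝓝 (T x)) := by
  have hC0 : 0 ≤ C := (norm_nonneg _).trans (hC 0)
  have heq : Equicontinuous fun k => (G k : Fock n → F) := by
    refine (LipschitzWith.uniformEquicontinuous (fun k => (G k : Fock n → F)) ⟨C, hC0⟩
      fun k => ?_).equicontinuous
    exact (G k).lipschitz.weaken (hC k)
  have hcl := heq.isClosed_setOfPred_tendsto (l := atTop) (f := T) T.continuous
  have hsp : (Submodule.span ℂ (Set.range (xi (n := n))) : Set (Fock n)) ⊆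
      {x | Tendsto (fun k => G k x) atTop (𝓝 (T x))} := by
    intro x hx
    induction hx using Submodule.span_induction with
    | mem x hx => obtain ⟨w, rfl⟩ := hx; exact h w
    | zero => simp
    | add x y _ _ hx hy => simpa using hx.add hy
    | smul c x _ hx => simpa using hx.const_smul c
  exact hcl.closure_subset_iff.mpr hsp (span_xi_dense n x)

/-- Uniformly bounded operators whose matrix entries converge do converge weakly. -/
theorem tendsto_inner_of_tendsto_entries {G : ℕ → FockOp n} {T : FockOp n} {C : ℝ}
    (hC : ∀ k, ‖G k‖ ≤ C)
    (h : ∀ u v, Tendsto (fun k => inner ℂ (xi u) (G k (xi v))) atTop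
      (𝓝 (inner ℂ (xi u) (T (xi v))))) (x y : Fock n) :
    Tendsto (fun k => inner ℂ y (G k x)) atTop (𝓝 (inner ℂ y (T x))) := by
  have h1 : ∀ u x, Tendsto (fun k => inner ℂ (xi u) (G k x)) atTop
      (𝓝 (inner ℂ (xi u) (T x))) := by
    intro u x
    refine tendsto_of_tendsto_xi (C := C) (G := fun k => innerSL ℂ (xi u) ∘L G k)
      (T := innerSL ℂ (xi u) ∘L T) (fun k => ?_) (h u) x
    refine (ContinuousLinearMap.opNorm_comp_le _ _).trans ?_
    rw [innerSL_apply_norm, norm_xi, one_mul]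
    exact hC k
  have h2 : Tendsto (fun k => inner ℂ (G k x) y) atTop (𝓝 (inner ℂ (T x) y)) := by
    refine tendsto_of_tendsto_xi (C := C * ‖x‖) (G := fun k => innerSL ℂ (G k x))
      (T := innerSL ℂ (T x)) (fun k => ?_) (fun u => ?_) y
    · rw [innerSL_apply_norm]
      exact (G k).le_of_opNorm_le (hC k) x
    · have := (Complex.continuous_conj.tendsto _).comp (h1 u x)
      simpa [Function.comp_def] using this
  have := (Complex.continuous_conj.tendsto _).comp h2
  simpa [Function.comp_def] using this

theorem opNorm_le_of_tendsto_entries {G : ℕ → FockOp n} {T : FockOp n} {C : ℝ}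
    (hC : ∀ k, ‖G k‖ ≤ C)
    (h : ∀ u v, Tendsto (fun k => inner ℂ (xi u) (G k (xi v))) atTop
      (𝓝 (inner ℂ (xi u) (T (xi v))))) : ‖T‖ ≤ C := by
  refine T.opNorm_le_of_re_inner_le ((norm_nonneg _).trans (hC 0)) fun x y hx hy => ?_
  refine (Complex.re_le_norm _).trans ?_
  rw [norm_inner_symm]
  refine le_of_tendsto (tendsto_inner_of_tendsto_entries hC h x y).norm
    (Eventually.of_forall fun k => ?_)
  refine (norm_inner_le_norm _ _).trans ?_
  rw [hy, one_mul]
  simpa [hx] using (G k).le_of_opNorm_le (hC k) x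

open scoped Classical in
/-- The orthogonal projection of Fock space onto the closed span of the `ξ_w` with `w ∈ S`. -/
def coordProj (S : Set (FreeMonoid (Fin n))) : FockOp n :=
  LinearMap.mkContinuous
    { toFun := fun x => ⟨fun w => if w ∈ S then x w else 0,
        (lp.memℓp x).mono' fun w => by split_ifs <;> simp⟩
      map_add' := fun x y => by
        ext w
        change (if w ∈ S then x w + y w else 0) =
          (if w ∈ S then x w else 0) + if w ∈ S then y w else 0
        split_ifs <;> simp
      map_smul' := fun c x => by ext w; simp } 1
    fun x => by
      rw [one_mul]
      refine lp.norm_mono (by simp) fun w => ?_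
      change ‖if w ∈ S then x w else 0‖ ≤ ‖x w‖
      split_ifs <;> simp

open scoped Classical in
theorem coordProj_apply (S : Set (FreeMonoid (Fin n))) (x : Fock n) (w : FreeMonoid (Fin n)) :
    coordProj S x w = if w ∈ S then x w else 0 := rfl

theorem norm_coordProj_le (S : Set (FreeMonoid (Fin n))) : ‖coordProj S‖ ≤ 1 :=
  LinearMap.mkContinuous_norm_le _ zero_le_one _

open scoped Classical in
theorem coordProj_xi (S : Set (FreeMonoid (Fin n))) (w : FreeMonoid (Fin n)) :
    coordProj S (xi w) = if w ∈ S then xi w else 0 := by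
  ext v
  rw [coordProj_apply]
  by_cases hvw : w = v
  · subst hvw; split_ifs <;> simp
  · have : (xi w : Fock n) v = 0 := by rw [xi_apply, if_neg hvw]
    split_ifs <;> simp [this]

theorem inner_coordProj (S : Set (FreeMonoid (Fin n))) (x y : Fock n) :
    inner ℂ y (coordProj S x) = inner ℂ (coordProj S y) x := by
  classical
  rw [lp.inner_eq_tsum, lp.inner_eq_tsum]
  refine tsum_congr fun w => ?_
  rw [coordProj_apply, coordProj_apply]
  split_ifs <;> simp

/-! ### Creation operators -/

/-- The isometry `R_v` of Fock space with `R_v ξ_w = ξ_{wv}`. -/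
def rightCreation (v : FreeMonoid (Fin n)) : Fock n →ₗᵢ[ℂ] Fock n :=
  ((orthonormal_xi n).comp (· * v) (mul_left_injective v)).orthogonalFamily.linearIsometry

theorem rightCreation_xi (v w : FreeMonoid (Fin n)) :
    rightCreation v (xi w) = (xi (w * v) : Fock n) := by
  classical
  change ((orthonormal_xi n).comp (· * v) (mul_left_injective v)).orthogonalFamily.linearIsometry
    (lp.single 2 w (1 : ℂ)) = _
  rw [OrthogonalFamily.linearIsometry_apply_single]
  simp

theorem rightCreation_apply_mul (v w : FreeMonoid (Fin n)) (x : Fock n) :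
    rightCreation v x (w * v) = x w := by
  rw [← inner_xi, ← rightCreation_xi, LinearIsometry.inner_map_map, inner_xi]

theorem rightCreation_apply_of_ne (v u : FreeMonoid (Fin n)) (x : Fock n)
    (h : ∀ w, u ≠ w * v) : rightCreation v x u = 0 := by
  have : innerSL ℂ (xi u) ∘L (rightCreation v).toContinuousLinearMap = 0 := by
    refine clm_ext_xi fun w => ?_
    have : inner ℂ (xi u : Fock n) (xi (w * v)) = 0 :=
      (orthonormal_xi n).2 (h w)
    simpa [rightCreation_xi] using this
  have h2 := congrArg (fun f => f x) this
  simpa [inner_xi] using h2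

/-- The operator `L_w = L_{i_1} ⋯ L_{i_k}` for a word `w = i_1 ⋯ i_k`. -/
def creation (w : FreeMonoid (Fin n)) : FockOp n := FreeMonoid.lift leftCreation w

theorem creation_xi (w v : FreeMonoid (Fin n)) : creation w (xi v) = (xi (w * v) : Fock n) := by
  induction w using FreeMonoid.inductionOn' generalizing v with
  | one => simp [creation]
  | of_mul i w ih =>
    rw [creation, map_mul, FreeMonoid.lift_eval_of]
    change leftCreation i (creation w (xi v)) = _
    rw [ih, leftCreation_xi, mul_assoc]

theorem polyAlgebra_toSubmodule (n : ℕ) :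
    Subalgebra.toSubmodule (polyAlgebra n) = Submodule.span ℂ (Set.range (creation (n := n))) := by
  rw [polyAlgebra, Algebra.adjoin_eq_span, ← FreeMonoid.mrange_lift]
  rfl

theorem creation_mem_polyAlgebra (w : FreeMonoid (Fin n)) : creation w ∈ polyAlgebra n := by
  rw [← Subalgebra.mem_toSubmodule, polyAlgebra_toSubmodule]
  exact Submodule.subset_span ⟨w, rfl⟩

/-! ### The commutant of the right creation operators -/

/-- The algebra of operators commuting with all right creation operators. It turns out to be
the algebra `𝔏ₙ`. -/
def rightCommutant (n : ℕ) : Subalgebra ℂ (FockOp n) :=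
  Subalgebra.centralizer ℂ (Set.range fun v => (rightCreation (n := n) v).toContinuousLinearMap)

theorem mem_rightCommutant {T : FockOp n} :
    T ∈ rightCommutant n ↔ ∀ v x, T (rightCreation v x) = rightCreation v (T x) := by
  simp only [rightCommutant, Subalgebra.mem_centralizer_iff, Set.forall_mem_range,
    ContinuousLinearMap.ext_iff]
  exact forall₂_congr fun v x => eq_comm

theorem polyAlgebra_le_rightCommutant (n : ℕ) : polyAlgebra n ≤ rightCommutant n := by
  refine Algebra.adjoin_le ?_
  rintro _ ⟨i, rfl⟩
  refine mem_rightCommutant.mpr fun v x => ?_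
  have : leftCreation i ∘L (rightCreation v).toContinuousLinearMap =
      (rightCreation v).toContinuousLinearMap ∘L leftCreation i :=
    clm_ext_xi fun w => by simp [rightCreation_xi, leftCreation_xi, mul_assoc]
  exact congrArg (fun f => f x) this

/-- Commutation with a fixed operator is preserved by limits in the weak operator topology. -/
theorem ncToeplitzAlgebra_le_rightCommutant (n : ℕ) : ncToeplitzAlgebra n ≤ rightCommutant n := by
  intro T hT
  refine mem_rightCommutant.mpr fun v x => ?_
  refine ext_inner_left ℂ fun y => ?_
  have hT' : (ContinuousLinearMapWOT.ofCLM T : Fock n →WOT[ℂ] Fock n) ∈ closure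
      (ContinuousLinearMapWOT.ofCLM '' (polyAlgebra n : Set (FockOp n))) := hT
  have hc := ContinuousLinearMapWOT.continuous_iff.mp
    (continuous_id (X := Fock n →WOT[ℂ] Fock n))
  have hcl : IsClosed {A : Fock n →WOT[ℂ] Fock n | inner ℂ y (A (rightCreation v x)) =
      inner ℂ (ContinuousLinearMap.adjoint (rightCreation v).toContinuousLinearMap y) (A x)} :=
    isClosed_eq (hc _ _) (hc _ _)
  have := closure_minimal (t := {A : Fock n →WOT[ℂ] Fock n | inner ℂ y (A (rightCreation v x)) =
      inner ℂ (ContinuousLinearMap.adjoint (rightCreation v).toContinuousLinearMap y) (A x)})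
      ?_ hcl hT'
  · have h2 : inner ℂ y (T (rightCreation v x)) =
      inner ℂ (ContinuousLinearMap.adjoint (rightCreation v).toContinuousLinearMap y) (T x) := this
    rw [h2, ContinuousLinearMap.adjoint_inner_left]
    rfl
  · rintro _ ⟨A, hA, rfl⟩
    change inner ℂ y (A (rightCreation v x)) =
      inner ℂ (ContinuousLinearMap.adjoint (rightCreation v).toContinuousLinearMap y) (A x)
    rw [ContinuousLinearMap.adjoint_inner_left,
      mem_rightCommutant.mp (polyAlgebra_le_rightCommutant n hA)]
    rfl

theorem apply_xi_of_mem_rightCommutant {T : FockOp n} (hT : T ∈ rightCommutant n)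
    (v : FreeMonoid (Fin n)) : T (xi v) = rightCreation v (T (xi 1)) := by
  rw [← mem_rightCommutant.mp hT, rightCreation_xi, one_mul]

/-! ### Fejér means -/

theorem finite_length_lt (n k : ℕ) : {w : FreeMonoid (Fin n) | w.length < k}.Finite :=
  List.finite_length_lt (Fin n) k

/-- The finite set of words of length less than `k`. -/
def wordsLT (n k : ℕ) : Finset (FreeMonoid (Fin n)) :=
  (finite_length_lt n k).toFinset

theorem mem_wordsLT {k : ℕ} {w : FreeMonoid (Fin n)} : w ∈ wordsLT n k ↔ w.length < k := by
  rw [wordsLT, Set.Finite.mem_toFinset, Set.mem_ofPred_eq]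

/-- The Fejér weight `max (1 - d / k) 0`; the truncated subtraction takes the positive part. -/
def fejerWeight (k d : ℕ) : ℂ := ((k - d : ℕ) : ℂ) / k

theorem fejerWeight_of_le {k d : ℕ} (h : k ≤ d) : fejerWeight k d = 0 := by
  simp [fejerWeight, Nat.sub_eq_zero_of_le h]

theorem tendsto_fejerWeight (d : ℕ) : Tendsto (fun k => fejerWeight k d) atTop (𝓝 1) := by
  have h : Tendsto (fun k : ℕ => 1 - (d : ℂ) / k) atTop (𝓝 (1 - 0)) :=
    tendsto_const_nhds.sub (tendsto_const_div_atTop_nhds_zero_nat (d : ℂ))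
  rw [sub_zero] at h
  refine h.congr' ?_
  filter_upwards [eventually_ge_atTop (d + 1)] with k hk
  have : (k : ℂ) ≠ 0 := by norm_cast; omega
  rw [fejerWeight, Nat.cast_sub (by omega), sub_div, div_self this]

/-- The `k`-th Fejér mean of the Fourier series `∑ a_w L_w`, where `T ξ_∅ = ∑ a_w ξ_w`. -/
def fejer (k : ℕ) : FockOp n →ₗ[ℂ] FockOp n where
  toFun T := ∑ w ∈ wordsLT n k, (fejerWeight k w.length * T (xi 1) w) • creation w
  map_add' S T := by
    rw [← Finset.sum_add_distrib]
    refine Finset.sum_congr rfl fun w _ => ?_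
    rw [add_apply, lp.coeFn_add, Pi.add_apply, mul_add, add_smul]
  map_smul' c T := by
    rw [Finset.smul_sum]
    refine Finset.sum_congr rfl fun w _ => ?_
    rw [smul_apply, lp.coeFn_smul, Pi.smul_apply, smul_smul, RingHom.id_apply,
      smul_eq_mul, mul_left_comm]

theorem fejer_apply (k : ℕ) (T : FockOp n) :
    fejer k T = ∑ w ∈ wordsLT n k, (fejerWeight k w.length * T (xi 1) w) • creation w := rfl

theorem fejer_mem_polyAlgebra (k : ℕ) (T : FockOp n) : fejer k T ∈ polyAlgebra n :=
  Subalgebra.sum_mem _ fun w _ => Subalgebra.smul_mem _ (creation_mem_polyAlgebra w) _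

theorem fejer_creation (k : ℕ) (w : FreeMonoid (Fin n)) :
    fejer k (creation w) = fejerWeight k w.length • creation w := by
  classical
  rw [fejer_apply]
  simp only [creation_xi, mul_one, xi_apply, mul_ite, mul_zero, ite_smul, zero_smul,
    Finset.sum_ite_eq, mem_wordsLT]
  split_ifs with h
  · rfl
  · rw [fejerWeight_of_le (not_lt.mp h), zero_smul]

/-- On the operators commuting with the right creation operators, the Fejér mean is a Schur
multiplier. -/
theorem inner_fejer {T : FockOp n} (hT : T ∈ rightCommutant n) (k : ℕ)
    (u v : FreeMonoid (Fin n)) :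
    inner ℂ (xi u) (fejer k T (xi v)) =
      fejerWeight k (u.length - v.length) * inner ℂ (xi u) (T (xi v)) := by
  classical
  rw [inner_xi, inner_xi, apply_xi_of_mem_rightCommutant hT,
    apply_xi_of_mem_rightCommutant
      (polyAlgebra_le_rightCommutant n (fejer_mem_polyAlgebra k T))]
  by_cases h : ∃ w, u = w * v
  · obtain ⟨w, rfl⟩ := h
    rw [rightCreation_apply_mul, rightCreation_apply_mul, FreeMonoid.length_mul,
      Nat.add_sub_cancel, ← inner_xi, fejer_apply, sum_apply, inner_sum]
    simp only [smul_apply, creation_xi, mul_one, inner_smul_right,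
      orthonormal_iff_ite.mp (orthonormal_xi n), mul_ite, mul_zero, Finset.sum_ite_eq, mem_wordsLT]
    split_ifs with h
    · rfl
    · rw [fejerWeight_of_le (not_lt.mp h), zero_mul]
  · push Not at h
    rw [rightCreation_apply_of_ne v u _ h, rightCreation_apply_of_ne v u _ h, mul_zero]

/-- The words whose length lies in the window `(s - k, s]`. -/
def window (n k s : ℕ) : Set (FreeMonoid (Fin n)) := {w | w.length ≤ s ∧ s < w.length + k}

theorem sum_norm_coordProj_window_sq_le (k N : ℕ) (x : Fock n) :
    ∑ s ∈ Finset.range N, ‖coordProj (window n k s) x‖ ^ 2 ≤ k * ‖x‖ ^ 2 := by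
  classical
  have h1 : HasSum (fun w => ∑ s ∈ Finset.range N, ‖coordProj (window n k s) x w‖ ^ 2)
      (∑ s ∈ Finset.range N, ‖coordProj (window n k s) x‖ ^ 2) :=
    hasSum_sum fun s _ => hasSum_norm_sq _
  refine hasSum_le (fun w => ?_) h1 ((hasSum_norm_sq x).mul_left (k : ℝ))
  have h2 : ∀ s, ‖coordProj (window n k s) x w‖ ^ 2 =
      if w ∈ window n k s then ‖x w‖ ^ 2 else 0 := by
    intro s
    rw [coordProj_apply]
    split_ifs <;> simp
  simp only [h2]
  rw [← Finset.sum_filter, Finset.sum_const, nsmul_eq_mul]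
  gcongr
  -- each word lies in exactly the windows with `s ∈ [|w|, |w| + k)`
  calc _ ≤ (Finset.Ico w.length (w.length + k)).card := by
        refine Finset.card_le_card fun s hs => ?_
        rw [Finset.mem_filter] at hs
        exact Finset.mem_Ico.mpr hs.2
    _ = k := by simp

/-- The sum of the compressions of `T` to the first `N` windows. -/
def windowSum (k N : ℕ) (T : FockOp n) : FockOp n :=
  ∑ s ∈ Finset.range N, coordProj (window n k s) ∘L T ∘L coordProj (window n k s)

/-- The windows overlap at most `k`-fold, so that the sum of the compressions has norm at most
`k ‖T‖` by the Cauchy–Schwarz inequality. -/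
theorem norm_windowSum_le (k N : ℕ) (T : FockOp n) : ‖windowSum k N T‖ ≤ k * ‖T‖ := by
  refine ContinuousLinearMap.opNorm_le_of_re_inner_le (by positivity) fun x y hx hy => ?_
  refine (Complex.re_le_norm _).trans ?_
  rw [norm_inner_symm, windowSum, sum_apply, inner_sum]
  have hsq : ∀ z : Fock n, ‖z‖ = 1 →
      √(∑ s ∈ Finset.range N, ‖coordProj (window n k s) z‖ ^ 2) ≤ √k := fun z hz =>
    Real.sqrt_le_sqrt (by simpa [hz] using sum_norm_coordProj_window_sq_le k N z)
  calc ‖∑ s ∈ Finset.range N, inner ℂ y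
          ((coordProj (window n k s) ∘L T ∘L coordProj (window n k s)) x)‖
      ≤ ∑ s ∈ Finset.range N,
          ‖T‖ * (‖coordProj (window n k s) y‖ * ‖coordProj (window n k s) x‖) := by
        refine norm_sum_le_of_le _ fun s _ => ?_
        rw [ContinuousLinearMap.comp_apply, ContinuousLinearMap.comp_apply, inner_coordProj,
          mul_left_comm]
        exact (norm_inner_le_norm _ _).trans
          (mul_le_mul_of_nonneg_left (T.le_opNorm _) (norm_nonneg _))
    _ = ‖T‖ * ∑ s ∈ Finset.range N,
          ‖coordProj (window n k s) y‖ * ‖coordProj (window n k s) x‖ := by rw [Finset.mul_sum]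
    _ ≤ ‖T‖ * (√k * √k) :=
        mul_le_mul_of_nonneg_left ((Real.sum_mul_le_sqrt_mul_sqrt _ _ _).trans
          (mul_le_mul (hsq y hy) (hsq x hx) (Real.sqrt_nonneg _) (Real.sqrt_nonneg _)))
          (norm_nonneg _)
    _ = k * ‖T‖ := by rw [Real.mul_self_sqrt (Nat.cast_nonneg k), mul_comm]

/-- Operators commuting with the right creation operators do not lower degrees. -/
theorem inner_eq_zero_of_length_lt {T : FockOp n} (hT : T ∈ rightCommutant n)
    {u v : FreeMonoid (Fin n)} (huv : u.length < v.length) :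
    inner ℂ (xi u) (T (xi v)) = 0 := by
  rw [inner_xi, apply_xi_of_mem_rightCommutant hT]
  refine rightCreation_apply_of_ne v u _ fun w hw => ?_
  rw [hw, FreeMonoid.length_mul] at huv
  omega

theorem inner_windowSum {k N : ℕ} {T : FockOp n} (hT : T ∈ rightCommutant n)
    (u : FreeMonoid (Fin n)) {v : FreeMonoid (Fin n)} (hN : v.length + k ≤ N) :
    inner ℂ (xi u) (windowSum k N T (xi v)) =
      ((k - (u.length - v.length) : ℕ) : ℂ) * inner ℂ (xi u) (T (xi v)) := by
  classical
  have h : ∀ s, inner ℂ (xi u)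
      ((coordProj (window n k s) ∘L T ∘L coordProj (window n k s)) (xi v)) =
      if u ∈ window n k s ∧ v ∈ window n k s then inner ℂ (xi u) (T (xi v)) else 0 := by
    intro s
    rw [ContinuousLinearMap.comp_apply, ContinuousLinearMap.comp_apply, inner_coordProj,
      coordProj_xi, coordProj_xi]
    by_cases h1 : u ∈ window n k s <;> by_cases h2 : v ∈ window n k s <;> simp [h1, h2]
  rw [windowSum, sum_apply, inner_sum]
  simp only [h]
  rw [← Finset.sum_filter, Finset.sum_const, nsmul_eq_mul]
  rcases lt_or_ge u.length v.length with huv | huv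
  · rw [inner_eq_zero_of_length_lt hT huv, mul_zero, mul_zero]
  congr 2
  have : (Finset.range N).filter (fun s => u ∈ window n k s ∧ v ∈ window n k s) =
      Finset.Ico u.length (v.length + k) := by
    ext s
    rw [Finset.mem_filter, Finset.mem_range, Finset.mem_Ico]
    simp only [window, Set.mem_ofPred_eq]
    omega
  rw [this, Nat.card_Ico]
  omega

theorem norm_fejer_le {T : FockOp n} (hT : T ∈ rightCommutant n) (k : ℕ) :
    ‖fejer k T‖ ≤ ‖T‖ := by
  rcases Nat.eq_zero_or_pos k with rfl | hk
  · have : wordsLT n 0 = ∅ := Finset.eq_empty_of_forall_notMem fun w hw => by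
      simp [mem_wordsLT] at hw
    simp [fejer_apply, this]
  have hk' : (k : ℂ) ≠ 0 := by exact_mod_cast hk.ne'
  have h : ‖(k : ℂ) • fejer k T‖ ≤ k * ‖T‖ := by
    refine opNorm_le_of_tendsto_entries (fun N => norm_windowSum_le k N T) fun u v => ?_
    refine tendsto_const_nhds.congr' ?_
    filter_upwards [eventually_ge_atTop (v.length + k)] with N hN
    rw [smul_apply, inner_smul_right, inner_fejer hT]
    rw [inner_windowSum hT u hN, fejerWeight]
    field_simp
  rw [norm_smul, Complex.norm_natCast] at h
  exact le_of_mul_le_mul_left h (by exact_mod_cast hk)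

theorem tendsto_inner_fejer {T : FockOp n} (hT : T ∈ rightCommutant n) (x y : Fock n) :
    Tendsto (fun k => inner ℂ y (fejer k T x)) atTop (𝓝 (inner ℂ y (T x))) := by
  refine tendsto_inner_of_tendsto_entries (norm_fejer_le hT) (fun u v => ?_) x y
  simp only [inner_fejer hT]
  simpa using (tendsto_fejerWeight _).mul_const (inner ℂ (xi u) (T (xi v)))

/-- The commutant theorem: `𝔏ₙ` is the commutant of the right creation operators. -/
theorem rightCommutant_eq_ncToeplitzAlgebra (n : ℕ) : rightCommutant n = ncToeplitzAlgebra n := by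
  refine le_antisymm (fun T hT => ?_) (ncToeplitzAlgebra_le_rightCommutant n)
  have : Tendsto (fun k => (ContinuousLinearMapWOT.ofCLM (fejer k T) : Fock n →WOT[ℂ] Fock n))
      atTop (𝓝 (ContinuousLinearMapWOT.ofCLM T)) := by
    rw [ContinuousLinearMapWOT.tendsto_iff_forall_inner_apply_tendsto]
    exact fun x y => tendsto_inner_fejer hT x y
  exact mem_closure_of_tendsto this
    (Eventually.of_forall fun k => ⟨_, fejer_mem_polyAlgebra k T, rfl⟩)

/-! ### Amplification of Fock space inside Fock space -/

/-- The words `b aⁱ` are no suffixes of one another, for distinct letters `a` and `b`. -/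
theorem of_mul_pow_suffix_injective {a b : Fin n} (hab : a ≠ b) {i j : ℕ}
    {v w : FreeMonoid (Fin n)}
    (h : v * (FreeMonoid.of b * FreeMonoid.of a ^ i) =
      w * (FreeMonoid.of b * FreeMonoid.of a ^ j)) : i = j := by
  have key : ∀ (x y : FreeMonoid (Fin n)) (c d : Fin n),
      x * FreeMonoid.of c = y * FreeMonoid.of d → x = y ∧ c = d := by
    intro x y c d h
    have h' : x.toList ++ [c] = y.toList ++ [d] := h
    obtain ⟨h1, h2⟩ := List.append_inj' h' rfl
    exact ⟨h1, by simpa using h2⟩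
  induction i generalizing j with
  | zero =>
    cases j with
    | zero => rfl
    | succ j =>
      rw [pow_zero, mul_one, pow_succ, ← mul_assoc, ← mul_assoc] at h
      exact absurd (key _ _ _ _ h).2.symm hab
  | succ i ih =>
    cases j with
    | zero =>
      rw [pow_zero, mul_one, pow_succ, ← mul_assoc, ← mul_assoc] at h
      exact absurd (key _ _ _ _ h).2 hab
    | succ j =>
      rw [pow_succ, pow_succ, ← mul_assoc (FreeMonoid.of b), ← mul_assoc (FreeMonoid.of b),
        ← mul_assoc v, ← mul_assoc w] at h
      rw [ih (key _ _ _ _ h).1]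

theorem inner_rightCreation_eq_zero {p q : FreeMonoid (Fin n)} (h : ∀ v w, v * p ≠ w * q)
    (x y : Fock n) : inner ℂ (rightCreation p x) (rightCreation q y) = 0 := by
  rw [lp.inner_eq_tsum]
  refine (tsum_congr fun u => ?_).trans tsum_zero
  by_cases hu : ∃ v, u = v * p
  · obtain ⟨v, rfl⟩ := hu
    rw [rightCreation_apply_of_ne q _ y (h v), inner_zero_right]
  · push Not at hu
    rw [rightCreation_apply_of_ne p _ x hu, inner_zero_left]

theorem orthogonalFamily_rightCreation {a b : Fin n} (hab : a ≠ b) :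
    OrthogonalFamily ℂ (fun _ : ℕ => Fock n)
      fun i => rightCreation (FreeMonoid.of b * FreeMonoid.of a ^ i) := by
  intro i j hij x y
  exact inner_rightCreation_eq_zero
    (fun v w hvw => hij (of_mul_pow_suffix_injective hab hvw)) x y

/-- Right creation operators with pairwise orthogonal ranges embed the Hilbert sum of countably
many copies of Fock space isometrically in Fock space. -/
def amplification {a b : Fin n} (hab : a ≠ b) : lp (fun _ : ℕ => Fock n) 2 →ₗᵢ[ℂ] Fock n :=
  (orthogonalFamily_rightCreation hab).linearIsometry

/-- The amplification intertwines `T ⊗ 1` with `T`, for every `T` that commutes with the right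
creation operators. -/
theorem hasSum_inner_amplification {a b : Fin n} (hab : a ≠ b) {T : FockOp n}
    (hT : T ∈ rightCommutant n) (x y : lp (fun _ : ℕ => Fock n) 2) :
    HasSum (fun i => inner ℂ (y i) (T (x i)))
      (inner ℂ (amplification hab y) (T (amplification hab x))) := by
  classical
  have h1 := (orthogonalFamily_rightCreation hab).hasSum_linearIsometry x
  have h3 : ∀ i, inner ℂ (amplification hab y) 
      (T (rightCreation (FreeMonoid.of b * FreeMonoid.of a ^ i) (x i))) =
      inner ℂ (y i) (T (x i)) := by
    intro i
    rw [mem_rightCommutant.mp hT,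
      ← (orthogonalFamily_rightCreation hab).linearIsometry_apply_single]
    exact ((amplification hab).inner_map_map y (lp.single 2 i (T (x i)))).trans
      (lp.inner_single_right i (T (x i)) y)
  simp only [← h3]
  exact h1.mapL (innerSL ℂ (amplification hab y) ∘L T)

/-- On the commutant of the right creation operators, a pairing with a trace class operator is the
pairing with a rank one operator. -/
theorem exists_vector_of_summable {a b : Fin n} (hab : a ≠ b) {x y : ℕ → Fock n}
    (hx : Summable fun i => ‖x i‖ ^ 2) (hy : Summable fun i => ‖y i‖ ^ 2) :
    ∃ ζ η : Fock n, ‖ζ‖ ^ 2 = ∑' i, ‖x i‖ ^ 2 ∧ ‖η‖ ^ 2 = ∑' i, ‖y i‖ ^ 2 ∧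
      ∀ T ∈ rightCommutant n, HasSum (fun i => inner ℂ (y i) (T (x i))) (inner ℂ η (T ζ)) := by
  have key : ∀ z : ℕ → Fock n, Summable (fun i => ‖z i‖ ^ 2) → Memℓp z 2 := fun z hz =>
    memℓp_gen (by simpa using hz)
  refine ⟨amplification hab ⟨x, key x hx⟩, amplification hab ⟨y, key y hy⟩, ?_, ?_, fun T hT =>
    hasSum_inner_amplification hab hT ⟨x, key x hx⟩ ⟨y, key y hy⟩⟩
  · rw [LinearIsometry.norm_map]
    exact (hasSum_norm_sq (⟨x, key x hx⟩ : lp (fun _ : ℕ => Fock n) 2)).tsum_eq.symm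
  · rw [LinearIsometry.norm_map]
    exact (hasSum_norm_sq (⟨y, key y hy⟩ : lp (fun _ : ℕ => Fock n) 2)).tsum_eq.symm

/-- Amplification by two copies: a sum of two vector functionals is a vector functional. -/
theorem exists_vector_add {a b : Fin n} (hab : a ≠ b) (x₁ y₁ x₂ y₂ : Fock n) :
    ∃ ζ η : Fock n, ‖ζ‖ ^ 2 = ‖x₁‖ ^ 2 + ‖x₂‖ ^ 2 ∧ ‖η‖ ^ 2 = ‖y₁‖ ^ 2 + ‖y₂‖ ^ 2 ∧
      ∀ T ∈ rightCommutant n,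
        inner ℂ η (T ζ) = inner ℂ y₁ (T x₁) + inner ℂ y₂ (T x₂) := by
  have hs : ∀ {M : Type} [AddCommMonoid M] [TopologicalSpace M] (f : ℕ → M),
      (∀ i, 2 ≤ i → f i = 0) → HasSum f (f 0 + f 1) := by
    intro M _ _ f hf
    have : HasSum f (∑ i ∈ Finset.range 2, f i) := hasSum_sum_of_ne_finset_zero
      fun i hi => hf i (by rw [Finset.mem_range] at hi; omega)
    simpa [Finset.sum_range_succ] using this
  let p : Fock n → Fock n → ℕ → Fock n :=
    fun z₁ z₂ i => if i = 0 then z₁ else if i = 1 then z₂ else 0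
  have hp : ∀ z₁ z₂, HasSum (fun i => ‖p z₁ z₂ i‖ ^ 2) (‖z₁‖ ^ 2 + ‖z₂‖ ^ 2) := fun z₁ z₂ => by
    simpa [p] using hs (fun i => ‖p z₁ z₂ i‖ ^ 2) fun i hi => by
      simp [p, show i ≠ 0 by omega, show i ≠ 1 by omega]
  obtain ⟨ζ, η, h1, h2, h3⟩ :=
    exists_vector_of_summable hab (hp x₁ x₂).summable (hp y₁ y₂).summable
  rw [(hp _ _).tsum_eq] at h1 h2
  refine ⟨ζ, η, h1, h2, fun T hT => (h3 T hT).unique ?_⟩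
  simpa [p] using hs (fun i => inner ℂ (p y₁ y₂ i) (T (p x₁ x₂ i))) fun i hi => by
      simp [p, show i ≠ 0 by omega, show i ≠ 1 by omega]

/-! ### Vector functionals -/

theorem toOp_leftRegular_mem_rightCommutant (A : NCDisk n) :
    NCToeplitz.toOp n (leftRegular n A) ∈ rightCommutant n :=
  ncToeplitzAlgebra_le_rightCommutant n (leftRegular n A).2

theorem toOp_mem_rightCommutant (T : NCToeplitz n) : NCToeplitz.toOp n T ∈ rightCommutant n :=
  ncToeplitzAlgebra_le_rightCommutant n T.2

/-- The inclusion of `𝔏ₙ` in `B(ℓ²(𝔽ₙ⁺))` as a linear isometry. -/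
def NCToeplitz.toOpₗᵢ (n : ℕ) : NCToeplitz n →ₗᵢ[ℂ] FockOp n where
  toLinearMap := (NCToeplitz.toOp n).toLinearMap
  norm_map' _ := rfl

/-- The inclusion of `𝔄ₙ` in `𝔏ₙ` as a linear isometry. -/
def leftRegularₗᵢ (n : ℕ) : NCDisk n →ₗᵢ[ℂ] NCToeplitz n where
  toLinearMap := (leftRegular n).toLinearMap
  norm_map' _ := rfl

/-- The functional `T ↦ ⟨Tζ, η⟩` on `𝔏ₙ`. -/
def toeplitzVectorFunctional (ζ η : Fock n) : BDual (NCToeplitz n) :=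
  innerSL ℂ η ∘L (ContinuousLinearMap.apply ℂ (Fock n) ζ) ∘L
    (NCToeplitz.toOpₗᵢ n).toContinuousLinearMap

theorem toeplitzVectorFunctional_apply (ζ η : Fock n) (T : NCToeplitz n) :
    toeplitzVectorFunctional ζ η T = inner ℂ η (NCToeplitz.toOp n T ζ) := rfl

/-- The functional `A ↦ ⟨λ(A)ζ, η⟩` on `𝔄ₙ`. -/
def vectorFunctional (ζ η : Fock n) : BDual (NCDisk n) :=
  toeplitzVectorFunctional ζ η ∘L (leftRegularₗᵢ n).toContinuousLinearMap

theorem vectorFunctional_apply (ζ η : Fock n) (A : NCDisk n) :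
    vectorFunctional ζ η A = inner ℂ η (NCToeplitz.toOp n (leftRegular n A) ζ) := rfl

theorem isVectorFunctional_iff {φ : BDual (NCDisk n)} {ζ η : Fock n} :
    IsVectorFunctional φ ζ η ↔ φ = vectorFunctional ζ η :=
  (ContinuousLinearMap.ext_iff (f := φ) (g := vectorFunctional ζ η)).symm

theorem norm_toOp (T : NCToeplitz n) : ‖NCToeplitz.toOp n T‖ = ‖T‖ := rfl

theorem norm_inner_apply_le (T : FockOp n) (ζ η : Fock n) :
    ‖inner ℂ η (T ζ)‖ ≤ ‖T‖ * (‖ζ‖ * ‖η‖) :=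
  calc ‖inner ℂ η (T ζ)‖ ≤ ‖η‖ * (‖T‖ * ‖ζ‖) :=
        (norm_inner_le_norm _ _).trans (mul_le_mul_of_nonneg_left (T.le_opNorm ζ) (norm_nonneg η))
    _ = ‖T‖ * (‖ζ‖ * ‖η‖) := by ring

theorem norm_vectorFunctional_le (ζ η : Fock n) : ‖vectorFunctional ζ η‖ ≤ ‖ζ‖ * ‖η‖ := by
  refine ContinuousLinearMap.opNorm_le_bound _ (by positivity) fun A => ?_
  rw [mul_comm]
  exact norm_inner_apply_le _ ζ η

/-- Elements of the unital algebra generated by `L_1, …, L_n` as elements of `𝔄ₙ`. -/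
def polyToDisk (n : ℕ) : polyAlgebra n →ₐ[ℂ] NCDisk n :=
  Subalgebra.inclusion (polyAlgebra n).le_topologicalClosure

theorem toOp_polyToDisk (p : polyAlgebra n) :
    NCToeplitz.toOp n (leftRegular n (polyToDisk n p)) = p := rfl

theorem norm_polyToDisk (p : polyAlgebra n) : ‖polyToDisk n p‖ = ‖(p : FockOp n)‖ := rfl

theorem denseRange_polyToDisk (n : ℕ) : DenseRange (polyToDisk n) :=
  (denseRange_inclusion_iff (polyAlgebra n).le_topologicalClosure).mpr subset_rfl

/-- A vector functional has the same norm on `𝔏ₙ` as on `𝔄ₙ`, since the Fejér means of an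
operator in `𝔏ₙ` lie in `𝔄ₙ`, have smaller norm and converge weakly. -/
theorem norm_inner_le_norm_vectorFunctional {T : FockOp n} (hT : T ∈ rightCommutant n)
    (ζ η : Fock n) : ‖inner ℂ η (T ζ)‖ ≤ ‖vectorFunctional ζ η‖ * ‖T‖ := by
  refine le_of_tendsto (tendsto_inner_fejer hT ζ η).norm (Eventually.of_forall fun k => ?_)
  have h := (vectorFunctional ζ η).le_opNorm (polyToDisk n ⟨_, fejer_mem_polyAlgebra k T⟩)
  rw [norm_polyToDisk] at h
  exact h.trans (mul_le_mul_of_nonneg_left (norm_fejer_le hT k) (norm_nonneg _))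

theorem norm_toeplitzVectorFunctional (ζ η : Fock n) :
    ‖toeplitzVectorFunctional ζ η‖ = ‖vectorFunctional ζ η‖ := by
  refine le_antisymm ?_ ?_
  · exact ContinuousLinearMap.opNorm_le_bound _ (norm_nonneg _) fun T =>
      norm_inner_le_norm_vectorFunctional (toOp_mem_rightCommutant T) ζ η
  · exact ContinuousLinearMap.opNorm_le_bound _ (norm_nonneg _) fun A =>
      (toeplitzVectorFunctional ζ η).le_opNorm (leftRegular n A)

/-- The space `𝔄ₙᵃ` of absolutely continuous functionals on `𝔄ₙ`. -/
def absContFunctionals {a b : Fin n} (hab : a ≠ b) : Submodule ℂ (BDual (NCDisk n)) where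
  carrier := {φ | IsAbsolutelyContinuous φ}
  zero_mem' := ⟨0, 0, fun A => by simp⟩
  add_mem' {φ ψ} hφ hψ := by
    obtain ⟨x₁, y₁, h₁⟩ := hφ
    obtain ⟨x₂, y₂, h₂⟩ := hψ
    obtain ⟨ζ, η, -, -, h⟩ := exists_vector_add hab x₁ y₁ x₂ y₂
    exact ⟨ζ, η, fun A => by
      rw [h _ (toOp_leftRegular_mem_rightCommutant A), add_apply, h₁, h₂]⟩
  smul_mem' c φ hφ := by
    obtain ⟨ζ, η, h⟩ := hφ
    exact ⟨c • ζ, η, fun A => by rw [map_smul, inner_smul_right, smul_apply, h, smul_eq_mul]⟩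

theorem mem_absContFunctionals {a b : Fin n} (hab : a ≠ b) {φ : BDual (NCDisk n)} :
    φ ∈ absContFunctionals hab ↔ IsAbsolutelyContinuous φ := Iff.rfl

theorem vectorFunctional_mem {a b : Fin n} (hab : a ≠ b) (ζ η : Fock n) :
    vectorFunctional ζ η ∈ absContFunctionals hab := ⟨ζ, η, fun _ => rfl⟩

/-! ### Factorization of functionals with control of norms -/

theorem vectorFunctional_add_left (ζ ζ' η : Fock n) :
    vectorFunctional (ζ + ζ') η = vectorFunctional ζ η + vectorFunctional ζ' η := by
  ext A
  simp [vectorFunctional_apply]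

theorem vectorFunctional_add_right (ζ η η' : Fock n) :
    vectorFunctional ζ (η + η') = vectorFunctional ζ η + vectorFunctional ζ η' := by
  ext A
  simp [vectorFunctional_apply]

theorem vectorFunctional_smul_left (c : ℂ) (ζ η : Fock n) :
    vectorFunctional (c • ζ) η = c • vectorFunctional ζ η := by
  ext A
  simp [vectorFunctional_apply]

theorem vectorFunctional_smul_right (c : ℂ) (ζ η : Fock n) :
    vectorFunctional ζ (c • η) = (starRingEnd ℂ) c • vectorFunctional ζ η := by
  ext A
  simp [vectorFunctional_apply, mul_comm]

/-- Every bounded functional on the space of vector functionals is the evaluation at an operator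
in `𝔏ₙ`: its values on vector functionals are a bounded sesquilinear form, hence come from an
operator, which commutes with the right creation operators. -/
theorem exists_op_of_dual (F : StrongDual ℂ (BDual (NCDisk n))) :
    ∃ T ∈ rightCommutant n, ∀ ζ η, inner ℂ η (T ζ) = F (vectorFunctional ζ η) := by
  let B : Fock n →L⋆[ℂ] Fock n →L[ℂ] ℂ := LinearMap.mkContinuous₂
    (LinearMap.mk₂'ₛₗ (starRingEnd ℂ) (RingHom.id ℂ) (fun η ζ => F (vectorFunctional ζ η))
      (fun η η' ζ => by rw [vectorFunctional_add_right, map_add])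
      (fun c η ζ => by rw [vectorFunctional_smul_right, map_smul])
      (fun η ζ ζ' => by rw [vectorFunctional_add_left, map_add])
      (fun c η ζ => by rw [vectorFunctional_smul_left, map_smul, RingHom.id_apply]))
    ‖F‖ fun η ζ => by
      refine (F.le_opNorm _).trans ?_
      rw [mul_assoc, mul_comm ‖η‖]
      exact mul_le_mul_of_nonneg_left (norm_vectorFunctional_le ζ η) (norm_nonneg F)
  let S : FockOp n := InnerProductSpace.continuousLinearMapOfBilin B
  have hS : ∀ ζ η, inner ℂ η (ContinuousLinearMap.adjoint S ζ) = F (vectorFunctional ζ η) := by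
    intro ζ η
    rw [ContinuousLinearMap.adjoint_inner_right]
    exact InnerProductSpace.continuousLinearMapOfBilin_apply B η ζ
  refine ⟨ContinuousLinearMap.adjoint S, mem_rightCommutant.mpr fun v x => ?_, hS⟩
  refine ext_inner_left ℂ fun y => ?_
  refine Eq.trans ?_ (ContinuousLinearMap.adjoint_inner_left (rightCreation v).toContinuousLinearMap
    (ContinuousLinearMap.adjoint S x) y)
  rw [hS, hS]
  congr 1
  ext A
  rw [vectorFunctional_apply, vectorFunctional_apply, ContinuousLinearMap.adjoint_inner_left,
    mem_rightCommutant.mp (toOp_leftRegular_mem_rightCommutant A)]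
  rfl

/-- The vector functionals of vectors of norm at most `√r`. -/
def vectorBall (n : ℕ) (r : ℝ) : Set (BDual (NCDisk n)) :=
  {φ | ∃ ζ η : Fock n, ‖ζ‖ ^ 2 ≤ r ∧ ‖η‖ ^ 2 ≤ r ∧ φ = vectorFunctional ζ η}

theorem convex_vectorBall {a b : Fin n} (hab : a ≠ b) (r : ℝ) : Convex ℝ (vectorBall n r) := by
  rintro _ ⟨x₁, y₁, hx₁, hy₁, rfl⟩ _ ⟨x₂, y₂, hx₂, hy₂, rfl⟩ s t hs ht hst
  -- the weights `s` and `t` are shared evenly between the two arguments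
  obtain ⟨ζ, η, hζ, hη, h⟩ := exists_vector_add hab ((√s : ℂ) • x₁) ((√s : ℂ) • y₁)
    ((√t : ℂ) • x₂) ((√t : ℂ) • y₂)
  have hb : ∀ x y : Fock n, ‖x‖ ^ 2 ≤ r → ‖y‖ ^ 2 ≤ r →
      ‖(√s : ℂ) • x‖ ^ 2 + ‖(√t : ℂ) • y‖ ^ 2 ≤ r := by
    intro x y hx hy
    simp only [norm_smul, mul_pow, Complex.norm_real, Real.norm_eq_abs, sq_abs, Real.sq_sqrt hs,
      Real.sq_sqrt ht]
    nlinarith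
  refine ⟨ζ, η, hζ.le.trans (hb _ _ hx₁ hx₂), hη.le.trans (hb _ _ hy₁ hy₂), ?_⟩
  have hsq : ∀ u : ℝ, 0 ≤ u → (√u : ℂ) * (√u : ℂ) = (u : ℂ) := fun u hu => by
    rw [← Complex.ofReal_mul, Real.mul_self_sqrt hu]
  ext A
  rw [vectorFunctional_apply, h _ (toOp_leftRegular_mem_rightCommutant A)]
  simp only [add_apply, smul_apply, vectorFunctional_apply, map_smul, inner_smul_left,
    inner_smul_right, Complex.conj_ofReal, ← mul_assoc, hsq s hs, hsq t ht, Complex.real_smul]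

/-- By the Hahn–Banach theorem, the absolutely continuous functionals of norm less than `r` are
approximated by vector functionals of vectors of norm at most `√r`: a separating functional would
be the evaluation at an operator in `𝔏ₙ`, where vector functionals have the same norm. -/
theorem mem_closure_vectorBall {a b : Fin n} (hab : a ≠ b) {r : ℝ} {ζ₀ η₀ : Fock n}
    (hr : ‖vectorFunctional ζ₀ η₀‖ < r) :
    vectorFunctional ζ₀ η₀ ∈ closure (vectorBall n r) := by
  by_contra hcon
  have hr0 : 0 < r := (norm_nonneg _).trans_lt hr
  obtain ⟨F, u, hF, hu⟩ := RCLike.geometric_hahn_banach_closed_point (𝕜 := ℂ)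
    (convex_vectorBall hab r).closure isClosed_closure hcon
  obtain ⟨T, hT, hTF⟩ := exists_op_of_dual F
  have hu0 : 0 < u := by
    have := hF 0 (subset_closure ⟨0, 0, by simpa using hr0.le, by simpa using hr0.le, by
      ext A; simp [vectorFunctional_apply]⟩)
    simpa using this
  -- vectors of norm `√r` give functionals in the ball, on which the real part of `F` is below `u`
  have hT' : ‖T‖ ≤ u / r := by
    refine T.opNorm_le_of_re_inner_le (by positivity) fun x y hx hy => ?_
    have hs : ∀ z : Fock n, ‖z‖ = 1 → ‖(√r : ℂ) • z‖ ^ 2 ≤ r := fun z hz => by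
      rw [norm_smul, hz, mul_one, Complex.norm_real, Real.norm_eq_abs, sq_abs, Real.sq_sqrt hr0.le]
    have := hF _ (subset_closure ⟨_, _, hs x hx, hs y hy, rfl⟩)
    rw [← hTF, map_smul, inner_smul_left, inner_smul_right, Complex.conj_ofReal, ← mul_assoc,
      ← Complex.ofReal_mul, Real.mul_self_sqrt hr0.le] at this
    rw [le_div_iff₀ hr0, mul_comm, inner_re_symm]
    simpa using this.le
  have h1 := norm_inner_le_norm_vectorFunctional hT ζ₀ η₀
  have h2 : u < ‖inner ℂ η₀ (T ζ₀)‖ := by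
    rw [hTF]
    exact hu.trans_le (Complex.re_le_norm _)
  have h3 : ‖vectorFunctional ζ₀ η₀‖ * ‖T‖ ≤ r * (u / r) :=
    mul_le_mul hr.le hT' (norm_nonneg _) hr0.le
  rw [mul_div_cancel₀ _ hr0.ne'] at h3
  linarith

/-- One step of the successive approximation of a functional by vector functionals. -/
theorem exists_vectorFunctional_near {a b : Fin n} (hab : a ≠ b) {φ : BDual (NCDisk n)}
    (hφ : φ ∈ (absContFunctionals hab).topologicalClosure) {r δ : ℝ} (hr : ‖φ‖ < r) (hδ : 0 < δ) :
    ∃ ζ η : Fock n, ‖ζ‖ ^ 2 ≤ r ∧ ‖η‖ ^ 2 ≤ r ∧ ‖φ - vectorFunctional ζ η‖ < δ := by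
  have hφ' : φ ∈ closure (absContFunctionals hab : Set (BDual (NCDisk n))) := hφ
  obtain ⟨φ', ⟨ζ₀, η₀, h₀⟩, hd⟩ := Metric.mem_closure_iff.mp hφ' (min (r - ‖φ‖) (δ / 2))
    (lt_min (sub_pos.mpr hr) (half_pos hδ))
  obtain rfl := isVectorFunctional_iff.mp h₀
  rw [lt_min_iff, dist_eq_norm] at hd
  have hr' : ‖vectorFunctional ζ₀ η₀‖ < r := by
    have := norm_sub_norm_le (vectorFunctional ζ₀ η₀) φ
    rw [norm_sub_rev] at this
    linarith [hd.1]
  obtain ⟨_, ⟨ζ, η, hζ, hη, rfl⟩, hd2⟩ :=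
    Metric.mem_closure_iff.mp (mem_closure_vectorBall hab hr') (δ / 2) (half_pos hδ)
  rw [dist_eq_norm] at hd2
  refine ⟨ζ, η, hζ, hη, ?_⟩
  have := norm_sub_le_norm_sub_add_norm_sub φ (vectorFunctional ζ₀ η₀) (vectorFunctional ζ η)
  linarith [hd.2]

/-- A norm limit `φ` of absolutely continuous functionals is given by vectors with
`‖ζ‖ ‖η‖ < ‖φ‖ + ε`: successive approximation writes `φ` as a series of vector functionals, which
the amplification turns into one vector functional. -/
theorem exists_vectorFunctional_eq {a b : Fin n} (hab : a ≠ b) {φ : BDual (NCDisk n)}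
    (hφ : φ ∈ (absContFunctionals hab).topologicalClosure) {ε : ℝ} (hε : 0 < ε) :
    ∃ ζ η : Fock n, IsVectorFunctional φ ζ η ∧ ‖ζ‖ * ‖η‖ < ‖φ‖ + ε := by
  -- the bounds `r k` on the squared norms of the `k`-th pair of vectors sum to `‖φ‖ + ε / 2`
  let r : ℕ → ℝ := fun k => (if k = 0 then ‖φ‖ else 0) + ε / 4 * (1 / 2) ^ k
  have hr0 : ‖φ‖ < r 0 := by simp [r, hε]
  have hrpos : ∀ k, 0 < r k := fun k => by
    dsimp only [r]; split_ifs <;> positivity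
  have hrsum : HasSum r (‖φ‖ + ε / 4 * 2) :=
    (hasSum_ite_eq 0 ‖φ‖).add (hasSum_geometric_two.mul_left (ε / 4))
  have step : ∀ (k : ℕ) (ψ : BDual (NCDisk n)),
      ψ ∈ (absContFunctionals hab).topologicalClosure ∧ ‖ψ‖ < r k →
      ∃ ζ η : Fock n, ‖ζ‖ ^ 2 ≤ r k ∧ ‖η‖ ^ 2 ≤ r k ∧
        ‖ψ - vectorFunctional ζ η‖ < r (k + 1) := fun k ψ h =>
    exists_vectorFunctional_near hab h.1 h.2 (hrpos _)
  choose! z e hz he hze using step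
  let ψ : ℕ → BDual (NCDisk n) :=
    fun k => Nat.rec φ (fun k χ => χ - vectorFunctional (z k χ) (e k χ)) k
  have hψsucc : ∀ k, ψ (k + 1) = ψ k - vectorFunctional (z k (ψ k)) (e k (ψ k)) := fun k => rfl
  have hψ : ∀ k, ψ k ∈ (absContFunctionals hab).topologicalClosure ∧ ‖ψ k‖ < r k := by
    intro k
    induction k with
    | zero => exact ⟨hφ, hr0⟩
    | succ k ih =>
      exact ⟨Submodule.sub_mem _ ih.1 ((absContFunctionals hab).le_topologicalClosure
        (vectorFunctional_mem hab _ _)), hze k _ ih⟩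
  have hzs : Summable fun k => ‖z k (ψ k)‖ ^ 2 :=
    hrsum.summable.of_nonneg_of_le (fun k => by positivity) fun k => hz k _ (hψ k)
  have hes : Summable fun k => ‖e k (ψ k)‖ ^ 2 :=
    hrsum.summable.of_nonneg_of_le (fun k => by positivity) fun k => he k _ (hψ k)
  obtain ⟨ζ, η, hζ, hη, h⟩ := exists_vector_of_summable hab hzs hes
  have hζ' : ‖ζ‖ ^ 2 ≤ ‖φ‖ + ε / 4 * 2 := by
    rw [hζ]
    exact hasSum_le (fun k => hz k _ (hψ k)) hzs.hasSum hrsum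
  have hη' : ‖η‖ ^ 2 ≤ ‖φ‖ + ε / 4 * 2 := by
    rw [hη]
    exact hasSum_le (fun k => he k _ (hψ k)) hes.hasSum hrsum
  refine ⟨ζ, η, fun A => ?_, ?_⟩
  · have hpart : ∀ N, ∑ k ∈ Finset.range N, vectorFunctional (z k (ψ k)) (e k (ψ k)) =
        φ - ψ N := by
      intro N
      induction N with
      | zero => simp [ψ]
      | succ N ih => rw [Finset.sum_range_succ, ih, hψsucc]; abel
    have hlim : Tendsto ψ atTop (𝓝 0) :=
      squeeze_zero_norm (fun k => (hψ k).2.le) hrsum.summable.tendsto_atTop_zero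
    have h1 := (h _ (toOp_leftRegular_mem_rightCommutant A)).tendsto_sum_nat
    have h2 : Tendsto (fun N => (φ - ψ N) A) atTop (𝓝 (φ A)) := by
      have := ((ContinuousLinearMap.apply ℂ ℂ A).continuous.tendsto _).comp
        (tendsto_const_nhds (x := φ).sub hlim)
      simpa [Function.comp_def] using this
    refine tendsto_nhds_unique h2 ?_
    refine h1.congr fun N => ?_
    rw [← hpart, sum_apply]
    rfl
  · nlinarith [sq_nonneg (‖ζ‖ - ‖η‖)]

theorem isClosed_absContFunctionals {a b : Fin n} (hab : a ≠ b) :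
    IsClosed (absContFunctionals hab : Set (BDual (NCDisk n))) := by
  refine isClosed_of_closure_subset fun φ hφ => ?_
  obtain ⟨ζ, η, h, -⟩ := exists_vectorFunctional_eq hab (φ := φ) hφ one_pos
  exact ⟨ζ, η, h⟩

/-! ### Powers of the augmentation ideal -/

theorem ncDisk_ext {A B : NCDisk n}
    (h : NCToeplitz.toOp n (leftRegular n A) = NCToeplitz.toOp n (leftRegular n B)) : A = B :=
  Subtype.ext h

/-- The operator `L_w` as an element of `𝔄ₙ`. -/
def diskCreation (w : FreeMonoid (Fin n)) : NCDisk n :=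
  polyToDisk n ⟨creation w, creation_mem_polyAlgebra w⟩

theorem toOp_diskCreation (w : FreeMonoid (Fin n)) :
    NCToeplitz.toOp n (leftRegular n (diskCreation w)) = creation w := rfl

theorem diskCreation_mul (v w : FreeMonoid (Fin n)) :
    diskCreation (v * w) = diskCreation v * diskCreation w :=
  ncDisk_ext (map_mul (FreeMonoid.lift leftCreation) v w)

theorem diskCreation_mem_augmentationIdeal {w : FreeMonoid (Fin n)} (hw : w ≠ 1) :
    diskCreation w ∈ augmentationIdeal n := by
  change inner ℂ (xi 1 : Fock n) (creation w (xi 1)) = 0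
  rw [creation_xi, mul_one]
  exact (orthonormal_xi n).2 hw.symm

theorem diskCreation_mem_augmentationIdeal_pow {k : ℕ} {w : FreeMonoid (Fin n)}
    (hw : k + 1 ≤ w.length) : diskCreation w ∈ augmentationIdeal n ^ (k + 1) := by
  induction k generalizing w with
  | zero =>
    rw [zero_add, pow_one]
    refine diskCreation_mem_augmentationIdeal fun h => ?_
    simp [h] at hw
  | succ k ih =>
    cases w using FreeMonoid.casesOn with
    | one => simp at hw
    | of_mul i w =>
      rw [pow_succ', diskCreation_mul]
      refine Submodule.mul_mem_mul
        (diskCreation_mem_augmentationIdeal (FreeMonoid.of_ne_one i)) (ih ?_)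
      rw [FreeMonoid.length_mul, FreeMonoid.length_of] at hw
      omega

/-- An operator commuting with the right creation operators whose constant Fourier coefficient
vanishes raises degrees by at least one. -/
theorem apply_eq_zero_of_mem_rightCommutant {T : FockOp n} (hT : T ∈ rightCommutant n)
    (hT0 : inner ℂ (xi 1) (T (xi 1)) = 0) {j : ℕ} {x : Fock n}
    (hx : ∀ u, u.length < j → x u = 0) {u : FreeMonoid (Fin n)} (hu : u.length < j + 1) :
    T x u = 0 := by
  have h := (hasSum_smul_xi x).mapL (innerSL ℂ (xi u) ∘L T)
  have hz : ∀ v, (innerSL ℂ (xi u) ∘L T) (x v • xi v) = 0 := by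
    intro v
    rcases lt_or_ge v.length j with hv | hv
    · rw [hx v hv, zero_smul, map_zero]
    rw [map_smul]
    refine smul_eq_zero_of_right _ ?_
    change inner ℂ (xi u) (T (xi v)) = 0
    rw [inner_xi, apply_xi_of_mem_rightCommutant hT]
    by_cases huv : ∃ w, u = w * v
    · obtain ⟨w, rfl⟩ := huv
      rw [FreeMonoid.length_mul] at hu
      obtain rfl : w = 1 := FreeMonoid.length_eq_zero.mp (by omega)
      rw [rightCreation_apply_mul, ← inner_xi, hT0]
    · push Not at huv
      exact rightCreation_apply_of_ne v u _ huv
  simp only [hz] at h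
  have := h.unique hasSum_zero
  rw [← inner_xi]
  exact this

/-- The elements of `𝔄ₙ,₀ᵏ` raise the degree by at least `k`. -/
theorem apply_eq_zero_of_mem_augmentationIdeal_pow {k : ℕ} {A : NCDisk n}
    (hA : A ∈ augmentationIdeal n ^ (k + 1)) {j : ℕ} {x : Fock n}
    (hx : ∀ u, u.length < j → x u = 0) {u : FreeMonoid (Fin n)} (hu : u.length < j + (k + 1)) :
    NCToeplitz.toOp n (leftRegular n A) x u = 0 := by
  induction k generalizing A j x u with
  | zero =>
    rw [zero_add, pow_one] at hA
    exact apply_eq_zero_of_mem_rightCommutant (toOp_leftRegular_mem_rightCommutant A) hA hx hu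
  | succ k ih =>
    rw [pow_succ] at hA
    induction hA using Submodule.mul_induction_on' with
    | mem_mul_mem B hB C hC =>
      rw [map_mul, map_mul]
      refine ih hB (j := j + 1) (fun v hv => ?_) (by omega)
      exact apply_eq_zero_of_mem_rightCommutant (toOp_leftRegular_mem_rightCommutant C) hC hx hv
    | add B _ C _ hB hC =>
      rw [map_add, map_add, add_apply, lp.coeFn_add, Pi.add_apply, hB, hC, add_zero]

theorem norm_comp_augmentationIdealPow_le {φ : BDual (NCDisk n)} {ζ η : Fock n}
    (h : IsVectorFunctional φ ζ η) (k : ℕ) :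
    ‖φ.comp (augmentationIdealPow n (k + 1)).subtypeL‖ ≤
      ‖coordProj {w | k + 1 ≤ w.length} η‖ * ‖ζ‖ := by
  classical
  refine ContinuousLinearMap.opNorm_le_bound _ (by positivity) fun ⟨A, hA⟩ => ?_
  change ‖φ A‖ ≤ _ * ‖A‖
  set x := NCToeplitz.toOp n (leftRegular n A) ζ with hx
  have h1 : coordProj {w | k + 1 ≤ w.length} x = x := by
    ext u
    rw [coordProj_apply]
    split_ifs with hu
    · rfl
    · refine (apply_eq_zero_of_mem_augmentationIdeal_pow hA (j := 0) (fun v hv => ?_) ?_).symm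
      · omega
      · simpa using hu
  rw [h A, ← hx, ← h1, inner_coordProj, mul_assoc]
  refine (norm_inner_le_norm _ _).trans (mul_le_mul_of_nonneg_left ?_ (norm_nonneg _))
  rw [mul_comm]
  exact (NCToeplitz.toOp n (leftRegular n A)).le_opNorm ζ

theorem tendsto_norm_comp_augmentationIdealPow {φ : BDual (NCDisk n)}
    (h : IsAbsolutelyContinuous φ) :
    Tendsto (fun k : ℕ => ‖φ.comp (augmentationIdealPow n k).subtypeL‖) atTop (𝓝 0) := by
  classical
  obtain ⟨ζ, η, h⟩ := h
  have hQ : Tendsto (fun k : ℕ => coordProj {w | k ≤ w.length} η) atTop (𝓝 0) := by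
    refine tendsto_of_tendsto_xi (T := (0 : FockOp n)) (fun k => norm_coordProj_le _)
      (fun w => ?_) η
    refine tendsto_const_nhds.congr' ?_
    filter_upwards [eventually_gt_atTop w.length] with k hk
    rw [coordProj_xi, if_neg (by simpa using hk)]
    rfl
  rw [← tendsto_add_atTop_iff_nat 1]
  refine squeeze_zero (fun k => ContinuousLinearMap.opNorm_nonneg _)
    (norm_comp_augmentationIdealPow_le h) ?_
  have h1 := (((tendsto_add_atTop_iff_nat 1).mpr hQ).norm).mul_const ‖ζ‖
  simpa using h1

/-! ### Approximation by de la Vallée Poussin means -/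

/-- The `k`-th Fejér mean of an element of `𝔄ₙ`, as an element of `𝔄ₙ`. -/
def diskFejer (k : ℕ) (A : NCDisk n) : NCDisk n :=
  polyToDisk n ⟨_, fejer_mem_polyAlgebra k (NCToeplitz.toOp n (leftRegular n A))⟩

theorem toOp_diskFejer (k : ℕ) (A : NCDisk n) :
    NCToeplitz.toOp n (leftRegular n (diskFejer k A)) =
      fejer k (NCToeplitz.toOp n (leftRegular n A)) := rfl

theorem norm_diskFejer_le (k : ℕ) (A : NCDisk n) : ‖diskFejer k A‖ ≤ ‖A‖ :=
  norm_fejer_le (toOp_leftRegular_mem_rightCommutant A) k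

theorem diskFejer_eq_sum (k : ℕ) (A : NCDisk n) :
    diskFejer k A = ∑ w ∈ wordsLT n k, (fejerWeight k w.length *
      NCToeplitz.toOp n (leftRegular n A) (xi 1) w) • diskCreation w := by
  refine ncDisk_ext ?_
  simp only [map_sum, map_smul, toOp_diskCreation]
  rfl

/-- The composition of a functional with a Fejér mean depends on finitely many Fourier
coefficients only, hence is a vector functional. -/
theorem exists_diskFejer_eq (φ : BDual (NCDisk n)) (k : ℕ) :
    ∃ η : Fock n, ∀ A, φ (diskFejer k A) = vectorFunctional (xi 1) η A := by
  refine ⟨∑ w ∈ wordsLT n k,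
    (starRingEnd ℂ) (fejerWeight k w.length * φ (diskCreation w)) • xi w, fun A => ?_⟩
  rw [diskFejer_eq_sum, vectorFunctional_apply, map_sum, sum_inner]
  refine Finset.sum_congr rfl fun w _ => ?_
  rw [map_smul, inner_smul_left, Complex.conj_conj, inner_xi, smul_eq_mul]
  ring

/-- The de la Vallée Poussin means `2 Σ_{2k} - Σ_k` leave the words of length at most `k`
unchanged, so that they approximate polynomials modulo `𝔄ₙ,₀ᵏ`. -/
theorem exists_mem_augmentationIdeal_pow_eq (k : ℕ) (p : polyAlgebra n) :
    ∃ B ∈ augmentationIdeal n ^ (k + 1), polyToDisk n p = B +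
      ((2 : ℂ) • diskFejer (2 * (k + 1)) (polyToDisk n p) -
        diskFejer (k + 1) (polyToDisk n p)) := by
  let V : FockOp n →ₗ[ℂ] FockOp n :=
    LinearMap.id - ((2 : ℂ) • fejer (2 * (k + 1)) - fejer (k + 1))
  let N : Submodule ℂ (FockOp n) := (augmentationIdeal n ^ (k + 1)).map
    ((NCToeplitz.toOp n).comp (leftRegular n)).toLinearMap
  have hle : Submodule.span ℂ (Set.range (creation (n := n))) ≤ N.comap V := by
    rw [Submodule.span_le]
    rintro _ ⟨w, rfl⟩
    have hV : V (creation w) = (1 - (2 * fejerWeight (2 * (k + 1)) w.length -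
        fejerWeight (k + 1) w.length)) • creation w := by
      simp only [V, LinearMap.sub_apply, LinearMap.smul_apply, LinearMap.id_apply, fejer_creation,
        sub_smul, one_smul, smul_smul]
    change V (creation w) ∈ N
    rw [hV]
    rcases le_or_gt w.length (k + 1) with hw | hw
    · have : 2 * fejerWeight (2 * (k + 1)) w.length - fejerWeight (k + 1) w.length = 1 := by
        have hk : (k : ℂ) + 1 ≠ 0 := by exact_mod_cast k.succ_ne_zero
        rw [fejerWeight, fejerWeight, Nat.cast_sub (by omega), Nat.cast_sub hw]
        push_cast
        field_simp
        ring
      rw [this, sub_self, zero_smul]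
      exact N.zero_mem
    · exact N.smul_mem _ ⟨diskCreation w, diskCreation_mem_augmentationIdeal_pow hw.le, rfl⟩
  have hp : (p : FockOp n) ∈ Submodule.span ℂ (Set.range (creation (n := n))) := by
    rw [← polyAlgebra_toSubmodule]
    exact p.2
  obtain ⟨B, hB, hBV⟩ := hle hp
  refine ⟨B, hB, ncDisk_ext ?_⟩
  have hBV' : NCToeplitz.toOp n (leftRegular n B) = (p : FockOp n) -
      ((2 : ℂ) • fejer (2 * (k + 1)) (p : FockOp n) - fejer (k + 1) (p : FockOp n)) := hBV
  simp only [map_add, map_sub, map_smul, toOp_diskFejer, toOp_polyToDisk, hBV']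
  abel

/-- If `φ` tends to zero on the ideals `𝔄ₙ,₀ᵏ`, it is the limit of its compositions with the
de la Vallée Poussin means, which are absolutely continuous. -/
theorem isAbsolutelyContinuous_of_tendsto {a b : Fin n} (hab : a ≠ b) {φ : BDual (NCDisk n)}
    (h : Tendsto (fun k : ℕ => ‖φ.comp (augmentationIdealPow n k).subtypeL‖) atTop (𝓝 0)) :
    IsAbsolutelyContinuous φ := by
  choose η hη using exists_diskFejer_eq φ
  let χ : ℕ → BDual (NCDisk n) := fun k =>
    (2 : ℂ) • vectorFunctional (xi 1) (η (2 * (k + 1))) - vectorFunctional (xi 1) (η (k + 1))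
  have hχ : ∀ k, χ k ∈ absContFunctionals hab := fun k =>
    Submodule.sub_mem _ (Submodule.smul_mem _ _ (vectorFunctional_mem hab _ _))
      (vectorFunctional_mem hab _ _)
  -- a de la Vallée Poussin mean has norm at most `3`, whence the factor `1 + 3 = 4`
  have hbound : ∀ k, ‖φ - χ k‖ ≤ ‖φ.comp (augmentationIdealPow n (k + 1)).subtypeL‖ * 4 := by
    intro k
    refine ContinuousLinearMap.opNorm_le_bound _ (by positivity) fun A => ?_
    refine (denseRange_polyToDisk n).induction_on
      (p := fun A => ‖(φ - χ k) A‖ ≤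
        ‖φ.comp (augmentationIdealPow n (k + 1)).subtypeL‖ * 4 * ‖A‖) A
      (isClosed_le (by fun_prop) (by fun_prop)) fun p => ?_
    obtain ⟨B, hB, hpB⟩ := exists_mem_augmentationIdeal_pow_eq k p
    generalize polyToDisk n p = A at hpB
    have h1 : (φ - χ k) A = φ.comp (augmentationIdealPow n (k + 1)).subtypeL ⟨B, hB⟩ := by
      change φ A - χ k A = φ B
      have : χ k A = (2 : ℂ) • φ (diskFejer (2 * (k + 1)) A) - φ (diskFejer (k + 1) A) := by
        rw [hη, hη]
        rfl
      rw [this, ← map_smul, ← map_sub, ← map_sub]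
      exact congrArg φ (sub_eq_of_eq_add hpB)
    have h2 : ‖B‖ ≤ 4 * ‖A‖ := by
      rw [eq_sub_of_add_eq hpB.symm]
      have h3 := norm_diskFejer_le (2 * (k + 1)) A
      have h4 := norm_diskFejer_le (k + 1) A
      have h5 : ‖(2 : ℂ) • diskFejer (2 * (k + 1)) A‖ = 2 * ‖diskFejer (2 * (k + 1)) A‖ := by
        rw [norm_smul, Complex.norm_ofNat]
      have h6 := norm_sub_le A ((2 : ℂ) • diskFejer (2 * (k + 1)) A - diskFejer (k + 1) A)
      have h7 := norm_sub_le ((2 : ℂ) • diskFejer (2 * (k + 1)) A) (diskFejer (k + 1) A)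
      linarith
    rw [h1, mul_assoc]
    refine (ContinuousLinearMap.le_opNorm _ _).trans ?_
    exact mul_le_mul_of_nonneg_left h2 (norm_nonneg _)
  have hlim : Tendsto χ atTop (𝓝 φ) := by
    rw [tendsto_iff_norm_sub_tendsto_zero]
    refine squeeze_zero (fun k => norm_nonneg _) (fun k => ?_)
      (by simpa using ((tendsto_add_atTop_iff_nat 1).mpr h).mul_const 4)
    rw [norm_sub_rev]
    exact hbound k
  exact (isClosed_absContFunctionals hab).mem_of_tendsto hlim (Eventually.of_forall hχ)

/-! ### The weak-* topology -/

/-- By amplification, the weak-* topology of `𝔏ₙ` is its weak operator topology. -/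
theorem weakStarTopology_eq {a b : Fin n} (hab : a ≠ b) : weakStarTopology n =
    ⨅ p : Fock n × Fock n, TopologicalSpace.induced
      (toeplitzVectorFunctional p.1 p.2 : NCToeplitz n → ℂ) inferInstance := by
  classical
  simp only [weakStarTopology, ultraweakTopology, induced_iInf, induced_compose]
  refine le_antisymm (le_iInf fun p => ?_) ?_
  · have hs : ∀ z : Fock n, Summable fun i => ‖(Pi.single 0 z : ℕ → Fock n) i‖ ^ 2 := fun z =>
      summable_of_ne_finset_zero (s := {0}) fun i hi => by
        simp [Pi.single_eq_of_ne (Finset.notMem_singleton.mp hi)]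
    refine (iInf₂_le_of_le (Pi.single 0 p.1) (Pi.single 0 p.2) <|
      iInf₂_le_of_le (hs _) (hs _) le_rfl).trans_eq ?_
    congr 1
    funext T
    simp only [Function.comp_apply, toeplitzVectorFunctional_apply]
    rw [tsum_eq_single 0 fun i hi => by simp [Pi.single_eq_of_ne hi]]
    simp
  · refine le_iInf₂ fun x y => le_iInf₂ fun hx hy => ?_
    obtain ⟨ζ, η, -, -, h⟩ := exists_vector_of_summable hab hx hy
    refine iInf_le_of_le (ζ, η) (le_of_eq ?_)
    congr 1
    funext T
    exact (h _ (toOp_mem_rightCommutant T)).tsum_eq.symm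

theorem isWeakStarContinuous_toeplitzVectorFunctional {a b : Fin n} (hab : a ≠ b)
    (ζ η : Fock n) :
    IsWeakStarContinuous (toeplitzVectorFunctional ζ η : NCToeplitz n → ℂ) := by
  rw [IsWeakStarContinuous, weakStarTopology_eq hab]
  exact continuous_iInf_dom (i := (ζ, η)) continuous_induced_dom

/-- Every weak-* continuous functional on `𝔏ₙ` is a vector functional. -/
theorem IsWeakStarContinuous.exists_eq {a b : Fin n} (hab : a ≠ b) {ψ : NCToeplitz n →ₗ[ℂ] ℂ}
    (hψ : IsWeakStarContinuous ψ) :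
    ∃ ζ η : Fock n, ∀ T, ψ T = toeplitzVectorFunctional ζ η T := by
  rw [IsWeakStarContinuous, weakStarTopology_eq hab] at hψ
  have hspan := (LinearMap.mem_span_iff_continuous
    (f := fun p : Fock n × Fock n => (toeplitzVectorFunctional p.1 p.2).toLinearMap) ψ).mpr hψ
  clear hψ
  induction hspan using Submodule.span_induction with
  | mem _ h =>
    obtain ⟨p, rfl⟩ := h
    exact ⟨p.1, p.2, fun T => rfl⟩
  | zero => exact ⟨0, 0, fun T => by simp [toeplitzVectorFunctional_apply]⟩
  | add f g _ _ hf hg =>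
    obtain ⟨x₁, y₁, h₁⟩ := hf
    obtain ⟨x₂, y₂, h₂⟩ := hg
    obtain ⟨ζ, η, -, -, h⟩ := exists_vector_add hab x₁ y₁ x₂ y₂
    exact ⟨ζ, η, fun T => by
      rw [LinearMap.add_apply, h₁, h₂]
      exact (h _ (toOp_mem_rightCommutant T)).symm⟩
  | smul c f _ hf =>
    obtain ⟨ζ, η, h⟩ := hf
    exact ⟨c • ζ, η, fun T => by
      rw [LinearMap.smul_apply, h, toeplitzVectorFunctional_apply, toeplitzVectorFunctional_apply,
        map_smul, inner_smul_right, smul_eq_mul]⟩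

/-! ### Duality -/

theorem exists_eq_of_mem_predual {a b : Fin n} (hab : a ≠ b) (ψ : predual n) :
    ∃ ζ η : Fock n, (ψ : BDual (NCToeplitz n)) = toeplitzVectorFunctional ζ η := by
  obtain ⟨ζ, η, h⟩ := IsWeakStarContinuous.exists_eq hab
    (ψ := (ψ : BDual (NCToeplitz n)).toLinearMap) ψ.2
  exact ⟨ζ, η, ContinuousLinearMap.ext h⟩

/-- The restriction of weak-* continuous functionals from `𝔏ₙ` to `𝔄ₙ`. -/
def predualRestrict {a b : Fin n} (hab : a ≠ b) : predual n →ₗᵢ[ℂ] absContFunctionals hab where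
  toFun ψ := ⟨(ψ : BDual (NCToeplitz n)) ∘L (leftRegularₗᵢ n).toContinuousLinearMap, by
    obtain ⟨ζ, η, h⟩ := exists_eq_of_mem_predual hab ψ
    rw [h]
    exact vectorFunctional_mem hab ζ η⟩
  map_add' _ _ := rfl
  map_smul' _ _ := rfl
  norm_map' ψ := by
    obtain ⟨ζ, η, h⟩ := exists_eq_of_mem_predual hab ψ
    change ‖(ψ : BDual (NCToeplitz n)) ∘L (leftRegularₗᵢ n).toContinuousLinearMap‖ =
      ‖(ψ : BDual (NCToeplitz n))‖
    rw [h]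
    exact (norm_toeplitzVectorFunctional ζ η).symm

theorem predualRestrict_surjective {a b : Fin n} (hab : a ≠ b) :
    Function.Surjective (predualRestrict hab) := by
  rintro ⟨φ, ζ, η, h⟩
  obtain rfl := isVectorFunctional_iff.mp h
  exact ⟨⟨toeplitzVectorFunctional ζ η, isWeakStarContinuous_toeplitzVectorFunctional hab ζ η⟩,
    rfl⟩

/-- The isometric isomorphism of the predual of `𝔏ₙ` with `𝔄ₙᵃ` given by restriction. -/
def predualEquiv {a b : Fin n} (hab : a ≠ b) : predual n ≃ₗᵢ[ℂ] absContFunctionals hab where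
  toLinearEquiv := LinearEquiv.ofBijective (predualRestrict hab).toLinearMap
    ⟨(predualRestrict hab).isometry.injective, predualRestrict_surjective hab⟩
  norm_map' := (predualRestrict hab).norm_map

theorem predualEquiv_symm_vectorFunctional {a b : Fin n} (hab : a ≠ b) (ζ η : Fock n) :
    ((predualEquiv hab).symm ⟨vectorFunctional ζ η, vectorFunctional_mem hab ζ η⟩ :
      BDual (NCToeplitz n)) = toeplitzVectorFunctional ζ η := by
  have : (⟨vectorFunctional ζ η, vectorFunctional_mem hab ζ η⟩ : absContFunctionals hab) =
      predualEquiv hab ⟨toeplitzVectorFunctional ζ η,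
        isWeakStarContinuous_toeplitzVectorFunctional hab ζ η⟩ := rfl
  rw [this, LinearIsometryEquiv.symm_apply_apply]

/-- The evaluation pairing of `𝔏ₙ` with `𝔄ₙᵃ`, through the identification of `𝔄ₙᵃ` with the
predual. -/
def dualPairing {a b : Fin n} (hab : a ≠ b) :
    NCToeplitz n →ₗ[ℂ] BDual (absContFunctionals hab) where
  toFun T := ContinuousLinearMap.apply ℂ ℂ T ∘L (predual n).subtypeL ∘L
    ((predualEquiv hab).symm : absContFunctionals hab →L[ℂ] predual n)
  map_add' S T := by
    ext φ
    exact map_add ((predualEquiv hab).symm φ : BDual (NCToeplitz n)) S T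
  map_smul' c T := by
    ext φ
    exact map_smul ((predualEquiv hab).symm φ : BDual (NCToeplitz n)) c T

theorem dualPairing_apply {a b : Fin n} (hab : a ≠ b) (T : NCToeplitz n)
    (φ : absContFunctionals hab) :
    dualPairing hab T φ = ((predualEquiv hab).symm φ : BDual (NCToeplitz n)) T := rfl

theorem dualPairing_vectorFunctional {a b : Fin n} (hab : a ≠ b) (T : NCToeplitz n)
    (ζ η : Fock n) :
    dualPairing hab T ⟨vectorFunctional ζ η, vectorFunctional_mem hab ζ η⟩ =
      inner ℂ η (NCToeplitz.toOp n T ζ) := by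
  rw [dualPairing_apply, predualEquiv_symm_vectorFunctional, toeplitzVectorFunctional_apply]

theorem norm_dualPairing {a b : Fin n} (hab : a ≠ b) (T : NCToeplitz n) :
    ‖dualPairing hab T‖ = ‖T‖ := by
  refine le_antisymm ?_ ?_
  · refine ContinuousLinearMap.opNorm_le_bound _ (norm_nonneg _) fun φ => ?_
    rw [dualPairing_apply, mul_comm]
    refine (ContinuousLinearMap.le_opNorm _ _).trans_eq ?_
    congr 1
    exact (predualEquiv hab).symm.norm_map φ
  · rw [← norm_toOp]
    refine ContinuousLinearMap.opNorm_le_of_re_inner_le (norm_nonneg _) fun x y hx hy => ?_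
    refine (Complex.re_le_norm _).trans ?_
    rw [norm_inner_symm, ← dualPairing_vectorFunctional hab]
    refine (ContinuousLinearMap.le_opNorm _ _).trans ?_
    refine mul_le_of_le_one_right (norm_nonneg _) ((norm_vectorFunctional_le x y).trans ?_)
    rw [hx, hy, one_mul]

theorem dualPairing_surjective {a b : Fin n} (hab : a ≠ b) :
    Function.Surjective (dualPairing hab) := by
  intro F
  obtain ⟨F', hF', -⟩ := exists_extension_norm_eq (absContFunctionals hab) F
  obtain ⟨T, hT, hTF⟩ := exists_op_of_dual F'
  rw [rightCommutant_eq_ncToeplitzAlgebra] at hT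
  refine ⟨(⟨T, hT⟩ : ncToeplitzAlgebra n), ?_⟩
  ext ⟨φ, ζ, η, h⟩
  obtain rfl := isVectorFunctional_iff.mp h
  refine (dualPairing_vectorFunctional hab _ ζ η).trans ?_
  exact (hTF ζ η).trans (hF' ⟨vectorFunctional ζ η, vectorFunctional_mem hab ζ η⟩)

/-- The isometric isomorphism of `𝔏ₙ` with the dual of `𝔄ₙᵃ`. -/
def dualEquiv {a b : Fin n} (hab : a ≠ b) :
    NCToeplitz n ≃ₗᵢ[ℂ] BDual (absContFunctionals hab) :=
  LinearIsometryEquiv.ofSurjective ⟨dualPairing hab, norm_dualPairing hab⟩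
    (dualPairing_surjective hab)

theorem weakStarTopology_eq_induced_dualEquiv {a b : Fin n} (hab : a ≠ b) :
    weakStarTopology n = TopologicalSpace.induced
      (fun T => StrongDual.toWeakDual (dualEquiv hab T)) inferInstance := by
  have h : TopologicalSpace.induced
      (fun T => StrongDual.toWeakDual (dualEquiv hab T)) inferInstance =
      ⨅ φ : absContFunctionals hab, TopologicalSpace.induced (fun T => dualPairing hab T φ)
        inferInstance := by
    refine (induced_compose (tγ := Pi.topologicalSpace)).trans ?_
    exact induced_to_pi _
  rw [weakStarTopology_eq hab, h]
  refine le_antisymm (le_iInf ?_) (le_iInf fun p => ?_)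
  · rintro ⟨φ, ζ, η, h⟩
    obtain rfl := isVectorFunctional_iff.mp h
    refine iInf_le_of_le (ζ, η) (le_of_eq ?_)
    congr 1
    funext T
    exact (dualPairing_vectorFunctional hab T ζ η).symm
  · refine iInf_le_of_le ⟨vectorFunctional p.1 p.2, vectorFunctional_mem hab _ _⟩ (le_of_eq ?_)
    congr 1
    funext T
    exact dualPairing_vectorFunctional hab T p.1 p.2

end FreeSemigroup

end

open FreeSemigroup in
theorem mainTheorem3 (n : ℕ) (hn : 2 ≤ n) :
    (∀ φ : BDual (NCDisk n),
      List.TFAE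
        [IsAbsolutelyContinuous φ,
          ∃ ψ : NCToeplitz n →ₗ[ℂ] ℂ, IsWeakStarContinuous ψ ∧
            ∀ A : NCDisk n, ψ (leftRegular n A) = φ A,
          Tendsto (fun k : ℕ => ‖φ.comp (augmentationIdealPow n k).subtypeL‖) atTop (𝓝 0)] ∧
      (IsAbsolutelyContinuous φ → ∀ ε : ℝ, 0 < ε →
        ∃ ζ η : Fock n, IsVectorFunctional φ ζ η ∧ ‖ζ‖ * ‖η‖ < ‖φ‖ + ε)) ∧
    ∃ M : Submodule ℂ (BDual (NCDisk n)),
      (∀ φ, φ ∈ M ↔ IsAbsolutelyContinuous φ) ∧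
      IsClosed (M : Set (BDual (NCDisk n))) ∧
      ∃ R : predual n ≃ₗᵢ[ℂ] M,
        (∀ (ψ : predual n) (A : NCDisk n),
          (R ψ : BDual (NCDisk n)) A =
            (ψ : BDual (NCToeplitz n)) (leftRegular n A)) ∧
        ∃ Θ : NCToeplitz n ≃ₗᵢ[ℂ] BDual M,
          (∀ (T : NCToeplitz n) (ψ : predual n),
            Θ T (R ψ) = (ψ : BDual (NCToeplitz n)) T) ∧
          weakStarTopology n =
            TopologicalSpace.induced (fun T => StrongDual.toWeakDual (Θ T)) inferInstance := by
  have hab : (⟨0, by omega⟩ : Fin n) ≠ ⟨1, by omega⟩ := by simp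
  refine ⟨fun φ => ⟨?_, fun hφ ε hε => ?_⟩, absContFunctionals hab,
    fun φ => mem_absContFunctionals hab, isClosed_absContFunctionals hab, predualEquiv hab,
    fun ψ A => rfl, dualEquiv hab, fun T ψ => ?_, weakStarTopology_eq_induced_dualEquiv hab⟩
  · tfae_have 1 → 2 := by
      rintro ⟨ζ, η, h⟩
      exact ⟨(toeplitzVectorFunctional ζ η).toLinearMap,
        isWeakStarContinuous_toeplitzVectorFunctional hab ζ η, fun A => (h A).symm⟩
    tfae_have 2 → 1 := by
      rintro ⟨ψ, hψ, h⟩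
      obtain ⟨ζ, η, hζη⟩ := hψ.exists_eq hab
      exact ⟨ζ, η, fun A => by rw [← h, hζη, toeplitzVectorFunctional_apply]⟩
    tfae_have 1 → 3 := tendsto_norm_comp_augmentationIdealPow
    tfae_have 3 → 1 := isAbsolutelyContinuous_of_tendsto hab
    tfae_finish
  · exact exists_vectorFunctional_eq hab ((absContFunctionals hab).le_topologicalClosure hφ) hε
  · change ((predualEquiv hab).symm (predualEquiv hab ψ) : BDual (NCToeplitz n)) T = _
    rw [LinearIsometryEquiv.symm_apply_apply]
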